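/- Let $X$ be a separable real Hilbert space and $Y=\mathbb{R}^J$. On a probability space let $(\epsilon,x)$ be a jointly Gaussian random variable in $Y\times X$, and let $\eta\sim\mathbb{Q}_0=\mathcal{N}(0,\mathcal{C}_\eta)$ be a Gaussian random variable in $Y$ with $\eta\perp x$ and $\eta\perp\epsilon$. Let $\mu_0=\mathcal{N}(\bar x,\mathcal{C}_x)$ denote the law of $x$ (the prior), let $\mathcal{G}_a:X\to Y$ be measurable, and let $y=\mathcal{G}_a(x)+\epsilon+\eta$. For $u\in X$ let $\tilde{\mathbb{Q}}_u$ be the conditional law of $y$ given $x=u$. Assume that for $\mu_0$-almost every $u$ one has $\tilde{\mathbb{Q}}_u\ll\mathbb{Q}_0$ and $$\frac{d\tilde{\mathbb{Q}}_u}{d\mathbb{Q}_0}(v)=\frac{1}{Z_0(v)}\exp(-\Phi(u;v))\quad\text{for }\mathbb{Q}_0\text{-a.e. }v,$$ where $Z_0:Y\to(0,\infty)$ is measurable and the potential $\Phi:X\times Y\to\mathbb{R}$ is $\mu_0\otimes\mathbb{Q}_0$-measurable and Lipschitz in its first argument on bounded sets: for every $r>0$ there is $K>0$ with $|\Phi(u_1;v)-\Phi(u_2;v)|\le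 K\|u_1-u_2\|_X$ whenever $\|u_1\|_X,\|u_2\|_X,|v|<r$. For $v\in Y$ let $\mu^v$ be the posterior measure $$\frac{d\mu^v}{d\mu_0}(u)=\frac{1}{Z(v)}\exp(-\Phi(u;v)),\qquad Z(v)=\int_X\exp(-\Phi(u;v))\,\mu_0(du).$$ Let $(E,\|\cdot\|_E)$ be the Cameron–Martin space of $\mu_0$. The Onsager–Machlup functional with data $v$ is $I_v(u)=\Phi(u;v)+\frac12\|u-\bar x\|_E^2$ if $u-\bar x\in E$, and $I_v(u)=+\infty$ otherwise. A point $\hat z\in X$ is a MAP estimator for a measure $\mu$ on $X$ if $$\lim_{\delta\downarrow0}\frac{\mu(B_\delta(\hat z))}{\sup_{u\in X}\mu(B_\delta(u))}=1 .$$ Then $\mu^v$ is the conditional law of $x$ given $y=v$ for almost every $v$ with respect to the law of $y$. Moreover, for every $v\in Y$ for which there is $M\in\mathbb{R}$ with $\Phi(u;v)\ge M$ for all $u\in X$: 1. every MAP estimator for $\mu^v$ minimises $I_v$ over $X$; 2. conversely, every minimiser $z^*$ of $I_v$ over $X$ lies in $\bar x+E$ and is a MAP estimator for $\mu^v$. 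-/

import Mathlib

open MeasureTheory ProbabilityTheory Filter Topology
open scoped ENNReal RealInnerProductSpace

noncomputable section

namespace BayesMAP

variable {X : Type*} [NormedAddCommGroup X] [InnerProductSpace ℝ X]
  [MeasurableSpace X] [BorelSpace X]

/-- The Cameron-Martin norm of `h` for a Gaussian measure `μ` on a Hilbert space, with value `∞`
off the Cameron-Martin space: the supremum of `⟪v, h⟫` over all `v` such that the linear
functional `⟪v, ·⟫` has variance at most one under `μ`, that is, `⟪C v, v⟫ ≤ 1` for the
covariance operator `C` of `μ`. -/
def cameronMartinNorm (μ : Measure X) (h : X) : ℝ≥0∞ :=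
  ⨆ (v : X) (_ : covarianceBilin μ v v ≤ 1), ENNReal.ofReal ⟪v, h⟫

/-- The Cameron-Martin space of a Gaussian measure, as a subset of the ambient space. -/
def cameronMartinSpace (μ : Measure X) : Set X := {h | cameronMartinNorm μ h ≠ ∞}

open Classical in
/-- The Onsager-Machlup functional for the prior `μ₀` and the potential `Φ` (at fixed data): it is
`Φ x + ‖x - x̄‖_E ^ 2 / 2` if `x - x̄` is in the Cameron-Martin space `E` of `μ₀`, where `x̄` is the
mean of `μ₀`, and `+∞` otherwise. -/
def onsagerMachlup (μ₀ : Measure X) (Φ : X → ℝ) (x : X) : EReal :=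
  if x - ∫ u, u ∂μ₀ ∈ cameronMartinSpace μ₀ then
    ((Φ x + 1 / 2 * (cameronMartinNorm μ₀ (x - ∫ u, u ∂μ₀)).toReal ^ 2 : ℝ) : EReal)
  else ⊤

/-- `z` is a maximum a posteriori (MAP) estimator for `μ`: the ratio of `μ (B_r(z))` to the supremum
of `μ (B_r(x))` over all centres `x` tends to one as the radius `r > 0` tends to zero. -/
def IsMAPEstimator (μ : Measure X) (z : X) : Prop :=
  Tendsto (fun r : ℝ => μ (Metric.ball z r) / ⨆ x : X, μ (Metric.ball x r)) (𝓝[>] 0) (𝓝 1)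

/-- The posterior measure for the prior `μ₀` and the potential `Φ` (at fixed data): its density with
respect to `μ₀` is `exp (-Φ x) / Z`, where `Z` is the integral of `exp (-Φ x)` under `μ₀`. -/
def posterior (μ₀ : Measure X) (Φ : X → ℝ) : Measure X :=
  μ₀.withDensity fun x => ENNReal.ofReal (Real.exp (-Φ x) / ∫ u, Real.exp (-Φ u) ∂μ₀)

end BayesMAP

end

/-!
For small `r`, the mass that the posterior gives to the ball `B_r(z)` is governed by
`exp (-I z) * μ₀ (B_r(x̄))`, where `I` is the Onsager–Machlup functional. The density contributes
`exp (-Φ z)` by continuity; the Cameron–Martin norm enters through shifts of the centred Gaussian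
measure `γ` of covariance `C`. By the Cameron–Martin formula,
`γ (B_r(u))` is the integral of `exp (-⟪v, x⟫ - ⟪C v, v⟫ / 2)` over `B_r(u - C v)`, for every `v`.
Bounding the integrand and using Anderson's inequality `γ (B_r(u - C v)) ≤ γ (B_r(0))` gives an
upper bound with exponent `-(⟪v, u⟫ - ⟪C v, v⟫ / 2) + r ‖v‖`, and the supremum of
`⟪v, u⟫ - ⟪C v, v⟫ / 2` over `v` is half the squared Cameron–Martin norm of `u`. Taking `u = C v`
and averaging over `±v` gives the matching lower bound at `C v`, which extends to the whole
Cameron–Martin space by density.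

Comparing two centres shows that MAP estimators minimise `I`. For the converse the upper bound has
to be uniform over all centres: centres violating it at radii `r → 0` satisfy
`⟪v, u⟫ ≤ R + ⟪C v, v⟫ / 2 + r ‖v‖` for all `v`, which forces relative compactness because `C` has
finite trace, and at a limit point the upper bound holds locally uniformly.

Bayes' formula holds because the joint law of `(x, y)` has density `exp (-Φ) / Z₀` with respect to
the product of the prior and the noise law, so that it can be disintegrated in either order.
-/

namespace BayesMAP

/-! ### The Cameron–Martin formula -/

section CameronMartin

variable {X : Type*} [NormedAddCommGroup X] [InnerProductSpace ℝ X] [MeasurableSpace X]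
  [BorelSpace X] {γ : Measure X}

lemma covarianceBilin_sq_le (γ : Measure X) (a b : X) :
    covarianceBilin γ a b ^ 2 ≤ covarianceBilin γ a a * covarianceBilin γ b b :=
  (covarianceBilin γ).toBilinForm.apply_sq_le_of_symm covarianceBilin_self_nonneg
    ⟨covarianceBilin_comm⟩ a b

lemma exists_covarianceBilin_sub_smul_eq_zero (γ : Measure X) (v t : X) :
    ∃ a : ℝ, covarianceBilin γ v (t - a • v) = 0 := by
  by_cases hv : covarianceBilin γ v v = 0
  · have hvt := covarianceBilin_sq_le γ v t
    rw [hv, zero_mul] at hvt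
    exact ⟨0, by simpa using pow_eq_zero_iff two_ne_zero |>.1 (le_antisymm hvt (sq_nonneg _))⟩
  · exact ⟨covarianceBilin γ v t / covarianceBilin γ v v, by simp [hv]⟩

variable [CompleteSpace X] [SecondCountableTopology X] [IsGaussian γ]

lemma indepFun_inner_of_covarianceBilin_eq_zero {a b : X} (hab : covarianceBilin γ a b = 0) :
    IndepFun (fun x => ⟪a, x⟫) (fun x => ⟪b, x⟫) γ := by
  have h := (IsGaussian.hasGaussianLaw_id (μ := γ)).map_fun ((innerSL ℝ a).prod (innerSL ℝ b))
  simp only [id, ContinuousLinearMap.prod_apply, innerSL_apply_apply] at h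
  refine h.indepFun_of_covariance_eq_zero ?_
  rwa [← covarianceBilin_apply_eq_cov IsGaussian.memLp_two_id]

lemma inner_covarianceOperator (h0 : ∫ x, x ∂γ = 0) (a b : X) :
    ⟪covarianceOperator γ a, b⟫ = covarianceBilin γ a b := by
  rw [covarianceOperator_inner IsGaussian.memLp_two_id,
    covarianceBilin_apply IsGaussian.memLp_two_id]
  simp [h0]

lemma map_inner_eq_gaussianReal (h0 : ∫ x, x ∂γ = 0) (a : X) :
    γ.map (fun x => ⟪a, x⟫) = gaussianReal 0 (covarianceBilin γ a a).toNNReal := by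
  have h := ((IsGaussian.hasGaussianLaw_id (μ := γ)).map_fun (innerSL ℝ a)).map_eq_gaussianReal
  simp only [id, innerSL_apply_apply] at h
  rw [h, covarianceBilin_self IsGaussian.memLp_two_id, integral_inner, h0, inner_zero_right]
  exact IsGaussian.integrable_id

lemma integral_cexp_mul_inner (h0 : ∫ x, x ∂γ = 0) (a : X) (z : ℂ) :
    ∫ x, Complex.exp (z * (⟪a, x⟫ : ℝ)) ∂γ =
      Complex.exp ((covarianceBilin γ a a : ℝ) * z ^ 2 / 2) := by
  have h := complexMGF_gaussianReal (map_inner_eq_gaussianReal h0 a) z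
  rw [complexMGF, Real.coe_toNNReal _ (covarianceBilin_self_nonneg _)] at h
  simpa using h

/- Split `t = a • v + w` with `w` orthogonal to `v` for the covariance: `⟪v, ·⟫` and `⟪w, ·⟫` are
then independent Gaussians, and the integral factorises. -/
lemma integral_cexp_inner_add (h0 : ∫ x, x ∂γ = 0) (v t : X) :
    ∫ x, Complex.exp ((⟪v, x⟫ : ℝ) + (⟪t, x⟫ : ℝ) * Complex.I) ∂γ =
      Complex.exp (((covarianceBilin γ v v - covarianceBilin γ t t) / 2 : ℝ)
        + (covarianceBilin γ v t : ℝ) * Complex.I) := by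
  obtain ⟨a, hvw⟩ := exists_covarianceBilin_sub_smul_eq_zero γ v t
  obtain ⟨w, rfl⟩ : ∃ w, t = a • v + w := ⟨t - a • v, by module⟩
  rw [add_sub_cancel_left] at hvw
  have hfactor : ∀ x, Complex.exp ((⟪v, x⟫ : ℝ) + (⟪a • v + w, x⟫ : ℝ) * Complex.I) =
      Complex.exp ((1 + a * Complex.I) * (⟪v, x⟫ : ℝ)) *
        Complex.exp (Complex.I * (⟪w, x⟫ : ℝ)) := fun x => by
    rw [← Complex.exp_add, inner_add_left, real_inner_smul_left]
    push_cast
    ring_nf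
  have hprod := (indepFun_inner_of_covarianceBilin_eq_zero hvw).integral_fun_comp_mul_comp
    (by fun_prop) (by fun_prop)
    (f := fun s : ℝ => Complex.exp ((1 + a * Complex.I) * (s : ℝ)))
    (g := fun s : ℝ => Complex.exp (Complex.I * (s : ℝ)))
    (Continuous.aestronglyMeasurable (by fun_prop)) (Continuous.aestronglyMeasurable (by fun_prop))
  simp_rw [hfactor]
  rw [hprod, integral_cexp_mul_inner h0, integral_cexp_mul_inner h0, ← Complex.exp_add]
  simp only [map_add, map_smul, add_apply, smul_apply, smul_eq_mul, covarianceBilin_comm w v, hvw]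
  push_cast
  congr 1
  linear_combination ((covarianceBilin γ w w : ℂ) + a ^ 2 * covarianceBilin γ v v) / 2 *
    Complex.I_sq

lemma integrable_exp_inner_sub (h0 : ∫ x, x ∂γ = 0) (v : X) (c : ℝ) :
    Integrable (fun x => Real.exp (⟪v, x⟫ - c)) γ := by
  have hi := Integrable.of_integral_ne_zero
    (integral_cexp_inner_add h0 v 0 ▸ Complex.exp_ne_zero _)
  refine (hi.norm.mul_const (Real.exp (-c))).congr (ae_of_all _ fun x => ?_)
  simp [Complex.norm_exp, sub_eq_add_neg, Real.exp_add]

theorem map_add_covarianceOperator (h0 : ∫ x, x ∂γ = 0) (v : X) :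
    γ.map (· + covarianceOperator γ v) =
      γ.withDensity fun x => ENNReal.ofReal (Real.exp (⟪v, x⟫ - covarianceBilin γ v v / 2)) := by
  have : IsFiniteMeasure (γ.withDensity fun x =>
      ENNReal.ofReal (Real.exp (⟪v, x⟫ - covarianceBilin γ v v / 2))) :=
    isFiniteMeasure_withDensity_ofReal (integrable_exp_inner_sub h0 v _).2
  refine Measure.ext_of_charFun (funext fun t => ?_)
  rw [charFun_map_add_const, IsGaussian.charFun_eq', charFun_apply,
    integral_withDensity_eq_integral_toReal_smul (by fun_prop) (ae_of_all _ fun _ => by simp),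
    inner_covarianceOperator h0]
  have hexp : ∀ x, (ENNReal.ofReal (Real.exp (⟪v, x⟫ - covarianceBilin γ v v / 2))).toReal •
      Complex.exp ((⟪x, t⟫ : ℝ) * Complex.I) =
      Complex.exp (-(covarianceBilin γ v v / 2 : ℝ)) *
        Complex.exp ((⟪v, x⟫ : ℝ) + (⟪t, x⟫ : ℝ) * Complex.I) := fun x => by
    rw [ENNReal.toReal_ofReal (Real.exp_pos _).le, Complex.real_smul, Complex.ofReal_exp,
      ← Complex.exp_add, ← Complex.exp_add, real_inner_comm t x]
    push_cast
    ring_nf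
  simp_rw [hexp]
  rw [integral_const_mul, integral_cexp_inner_add h0, ← Complex.exp_add, ← Complex.exp_add]
  simp only [id, h0, inner_zero_right]
  push_cast
  ring_nf

end CameronMartin

/-! ### Anderson's inequality -/

/- The bathtub principle. -/
lemma setLIntegral_le_setLIntegral_of_superlevel {α : Type*} [MeasurableSpace α] {μ : Measure α}
    {A B : Set α} {f : α → ℝ≥0∞} {k : ℝ≥0∞} (hA : MeasurableSet A) (hB : MeasurableSet B)
    (hBA : μ B ≤ μ A) (hfin : μ A ≠ ∞) (hkf : ∀ x ∈ A, k ≤ f x) (hfk : ∀ x ∉ A, f x ≤ k) :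
    ∫⁻ x in B, f x ∂μ ≤ ∫⁻ x in A, f x ∂μ := by
  have hdiff : μ (B \ A) ≤ μ (A \ B) := by
    rw [← measure_inter_add_sdiff B hA, ← measure_inter_add_sdiff A hB, Set.inter_comm B A] at hBA
    exact (ENNReal.add_le_add_iff_left
      (ne_top_of_le_ne_top hfin (measure_mono Set.inter_subset_left))).1 hBA
  rw [← lintegral_inter_add_sdiff f B hA, ← lintegral_inter_add_sdiff f A hB, Set.inter_comm B A]
  gcongr 1
  calc ∫⁻ x in B \ A, f x ∂μ ≤ ∫⁻ _ in B \ A, k ∂μ :=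
        setLIntegral_mono' (hB.diff hA) fun x hx => hfk x hx.2
    _ ≤ ∫⁻ _ in A \ B, k ∂μ := by simpa using mul_le_mul_right hdiff k
    _ ≤ ∫⁻ x in A \ B, f x ∂μ := setLIntegral_mono' (hA.diff hB) fun x hx => hkf x hx.1

lemma gaussianReal_zero_setOf_sub_sq_le (v : NNReal) (c r : ℝ) :
    gaussianReal 0 v {t | (t - c) ^ 2 ≤ r} ≤ gaussianReal 0 v {t | t ^ 2 ≤ r} := by
  rcases lt_or_ge r 0 with hr | hr
  · have hempty : {t : ℝ | (t - c) ^ 2 ≤ r} = ∅ :=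
      Set.eq_empty_of_forall_notMem fun t ht => (hr.trans_le (sq_nonneg (t - c))).not_ge ht
    simp [hempty]
  have hmeas : MeasurableSet {t : ℝ | t ^ 2 ≤ r} := measurableSet_le (by fun_prop) (by fun_prop)
  rcases eq_or_ne v 0 with rfl | hv
  · rw [gaussianReal_zero_var, Measure.dirac_apply' 0 hmeas, Set.indicator_of_mem (by simpa)]
    exact prob_le_one
  have hvol : volume {t : ℝ | (t - c) ^ 2 ≤ r} = volume {t : ℝ | t ^ 2 ≤ r} :=
    (measurePreserving_sub_right volume c).measure_preimage hmeas.nullMeasurableSet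
  have hfin : volume {t : ℝ | t ^ 2 ≤ r} ≠ ∞ := by
    have hsub : {t : ℝ | t ^ 2 ≤ r} ⊆ Set.Icc (-√r) (√r) := fun t ht =>
      abs_le.1 (Real.abs_le_sqrt ht)
    exact ((measure_mono hsub).trans_lt (by simp)).ne
  have hpdf : ∀ s t : ℝ, s ^ 2 ≤ t ^ 2 → gaussianPDF 0 v t ≤ gaussianPDF 0 v s := fun s t hst => by
    simp only [gaussianPDF, gaussianPDFReal, sub_zero]
    gcongr
  rw [gaussianReal_apply 0 hv, gaussianReal_apply 0 hv]
  refine setLIntegral_le_setLIntegral_of_superlevel (k := gaussianPDF 0 v √r) hmeas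
    (measurableSet_le (by fun_prop) (by fun_prop)) hvol.le hfin
    (fun t ht => hpdf t √r ?_) (fun t ht => hpdf √r t ?_) <;> rw [Real.sq_sqrt hr]
  exacts [ht, (not_le.1 ht).le]

section Anderson

variable {X : Type*} [NormedAddCommGroup X] [InnerProductSpace ℝ X]

lemma inner_sub_inner_smul {e : X} (he : ‖e‖ = 1) (x : X) : ⟪e, x - ⟪e, x⟫ • e⟫ = 0 := by
  rw [inner_sub_right, real_inner_smul_right, real_inner_self_eq_norm_sq, he]
  ring

lemma norm_sq_eq_inner_sq_add {e : X} (he : ‖e‖ = 1) (x : X) :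
    ‖x‖ ^ 2 = ⟪e, x⟫ ^ 2 + ‖x - ⟪e, x⟫ • e‖ ^ 2 := by
  conv_lhs => rw [← add_sub_cancel (⟪e, x⟫ • e) x]
  rw [norm_add_sq_real, norm_smul, he, real_inner_smul_left, inner_sub_inner_smul he]
  simp

variable [CompleteSpace X] [SecondCountableTopology X] [MeasurableSpace X] [BorelSpace X]
  {γ : Measure X} [IsGaussian γ]

lemma indepFun_inner_sub_inner_smul {e : X} (he : ‖e‖ = 1)
    (hC : ∀ w, ⟪e, w⟫ = 0 → covarianceBilin γ e w = 0) :
    IndepFun (fun x => ⟪e, x⟫) (fun x => x - ⟪e, x⟫ • e) γ := by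
  have h := (IsGaussian.hasGaussianLaw_id (μ := γ)).map_fun
    ((innerSL ℝ e).prod (ContinuousLinearMap.id ℝ X - (innerSL ℝ e).smulRight e))
  refine HasGaussianLaw.indepFun_of_covariance_inner (by simpa using h) fun a y => ?_
  have hleft : (fun x => ⟪a, ⟪e, x⟫⟫) = fun x => ⟪a • e, x⟫ := by
    ext x
    simp [real_inner_smul_left, mul_comm]
  have hright : (fun x => ⟪y, x - ⟪e, x⟫ • e⟫) = fun x => ⟪y - ⟪e, y⟫ • e, x⟫ := by
    ext x
    simp only [inner_sub_left, inner_sub_right, real_inner_smul_left, real_inner_smul_right,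
      real_inner_comm e]
    ring
  rw [hleft, hright, ← covarianceBilin_apply_eq_cov IsGaussian.memLp_two_id, map_smul, smul_apply,
    hC _ (inner_sub_inner_smul he y), smul_zero]

lemma measure_setOf_norm_sub_sq_le (h0 : ∫ x, x ∂γ = 0) {e : X} (he : ‖e‖ = 1)
    (hC : ∀ w, ⟪e, w⟫ = 0 → covarianceBilin γ e w = 0) (z : X) (r : ℝ) :
    γ {x | ‖x - z‖ ^ 2 ≤ r} = ∫⁻ w, gaussianReal 0 (covarianceBilin γ e e).toNNReal
      {t | (t - ⟪e, z⟫) ^ 2 ≤ r - ‖w - (z - ⟪e, z⟫ • e)‖ ^ 2} ∂γ.map (fun x => x - ⟪e, x⟫ • e) := by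
  have hmeas : MeasurableSet
      {p : ℝ × X | (p.1 - ⟪e, z⟫) ^ 2 ≤ r - ‖p.2 - (z - ⟪e, z⟫ • e)‖ ^ 2} :=
    measurableSet_le (by fun_prop) (by fun_prop)
  have hpre : {x | ‖x - z‖ ^ 2 ≤ r} = (fun x => (⟪e, x⟫, x - ⟪e, x⟫ • e)) ⁻¹'
      {p : ℝ × X | (p.1 - ⟪e, z⟫) ^ 2 ≤ r - ‖p.2 - (z - ⟪e, z⟫ • e)‖ ^ 2} := by
    ext x
    have hsub : x - z - ⟪e, x - z⟫ • e = x - ⟪e, x⟫ • e - (z - ⟪e, z⟫ • e) := by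
      rw [inner_sub_right]
      module
    rw [Set.mem_ofPred_eq, norm_sq_eq_inner_sq_add he, hsub, inner_sub_right]
    exact le_sub_iff_add_le.symm
  rw [hpre, ← Measure.map_apply (by fun_prop) hmeas,
    (indepFun_iff_map_prod_eq_prod_map_map (by fun_prop) (by fun_prop)).1
      (indepFun_inner_sub_inner_smul he hC),
    map_inner_eq_gaussianReal h0, Measure.prod_apply_symm hmeas]
  rfl

lemma measure_closedBall_le_sub_inner_smul (h0 : ∫ x, x ∂γ = 0) {e : X} (he : ‖e‖ = 1)
    (hC : ∀ w, ⟪e, w⟫ = 0 → covarianceBilin γ e w = 0) (u : X) (δ : ℝ) :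
    γ (Metric.closedBall u δ) ≤ γ (Metric.closedBall (u - ⟪e, u⟫ • e) δ) := by
  rcases lt_or_ge δ 0 with hδ | hδ
  · simp [Metric.closedBall_eq_empty.2 hδ]
  have hball : ∀ z : X, Metric.closedBall z δ = {x | ‖x - z‖ ^ 2 ≤ δ ^ 2} := fun z => by
    ext x
    simp [dist_eq_norm, sq_le_sq₀ (norm_nonneg _) hδ]
  rw [hball, hball, measure_setOf_norm_sub_sq_le h0 he hC, measure_setOf_norm_sub_sq_le h0 he hC,
    inner_sub_inner_smul he]
  simp only [zero_smul, sub_zero]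
  exact lintegral_mono fun w => gaussianReal_zero_setOf_sub_sq_le _ _ _

/- The coordinates of the centre along an orthonormal eigenbasis of the covariance operator are
moved to zero one at a time. -/
lemma measure_closedBall_le_of_finiteDimensional [FiniteDimensional ℝ X] (h0 : ∫ x, x ∂γ = 0)
    (u : X) (δ : ℝ) : γ (Metric.closedBall u δ) ≤ γ (Metric.closedBall 0 δ) := by
  have hsymm := (isPositive_covarianceOperator (μ := γ)).isSymmetric
  let b := hsymm.eigenvectorBasis rfl
  have hC : ∀ i w, ⟪b i, w⟫ = 0 → covarianceBilin γ (b i) w = 0 := fun i w hw => by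
    have hb : covarianceOperator γ (b i) = _ := hsymm.apply_eigenvectorBasis rfl i
    rw [← inner_covarianceOperator h0, hb, real_inner_smul_left, hw, mul_zero]
  have hcoord : ∀ s : Finset (Fin (Module.finrank ℝ X)), ∃ u', (∀ i ∈ s, ⟪b i, u'⟫ = 0) ∧
      γ (Metric.closedBall u δ) ≤ γ (Metric.closedBall u' δ) := fun s => by
    induction s using Finset.induction_on with
    | empty => exact ⟨u, by simp, le_rfl⟩
    | insert j s hj ih =>
      obtain ⟨u', hu', hle⟩ := ih
      refine ⟨u' - ⟪b j, u'⟫ • b j, fun i hi => ?_, hle.trans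
        (measure_closedBall_le_sub_inner_smul h0 (b.norm_eq_one j) (hC j) u' δ)⟩
      rcases eq_or_ne i j with rfl | hij
      · exact inner_sub_inner_smul (b.norm_eq_one i) u'
      · simp [inner_sub_right, real_inner_smul_right, b.inner_eq_zero hij,
          hu' i (Finset.mem_of_mem_insert_of_ne hi hij)]
  obtain ⟨u', hu', hle⟩ := hcoord Finset.univ
  have hzero : u' = 0 := by
    rw [← b.sum_repr' u']
    exact Finset.sum_eq_zero fun i hi => by rw [hu' i hi, zero_smul]
  rwa [hzero] at hle

end Anderson

lemma exists_monotone_finiteDimensional_tendsto_starProjection (X : Type*) [NormedAddCommGroup X]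
    [InnerProductSpace ℝ X] [SecondCountableTopology X] :
    ∃ V : ℕ → Submodule ℝ X, ∃ _ : ∀ n, FiniteDimensional ℝ (V n), Monotone V ∧
      ∀ x, Tendsto (fun n => (V n).starProjection x) atTop (𝓝 x) := by
  let V : ℕ → Submodule ℝ X := fun n =>
    Submodule.span ℝ (TopologicalSpace.denseSeq X '' (Set.Iio n))
  have hfin : ∀ n, FiniteDimensional ℝ (V n) := fun n =>
    FiniteDimensional.span_of_finite ℝ ((Set.finite_Iio n).image _)
  have hmono : Monotone V := fun m n hmn =>
    Submodule.span_mono (Set.image_mono (Set.Iio_subset_Iio hmn))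
  have hsub : Set.range (TopologicalSpace.denseSeq X) ⊆ ((⨆ n, V n : Submodule ℝ X) : Set X) := by
    rintro _ ⟨n, rfl⟩
    exact (le_iSup V (n + 1)) (Submodule.subset_span ⟨n, Nat.lt_succ_self n, rfl⟩)
  refine ⟨V, hfin, hmono, fun x => Submodule.starProjection_tendsto_self V hmono x fun y _ => ?_⟩
  rw [← SetLike.mem_coe, Submodule.topologicalClosure_coe]
  exact closure_mono hsub (TopologicalSpace.denseRange_denseSeq X y)

lemma measure_ball_eq_iSup_lt {X : Type*} [PseudoMetricSpace X] [MeasurableSpace X] (μ : Measure X)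
    (x : X) (δ : ℝ) : μ (Metric.ball x δ) = ⨆ r < δ, μ (Metric.ball x r) := by
  refine le_antisymm ?_ (iSup₂_le fun r hr => measure_mono (Metric.ball_subset_ball hr.le))
  obtain ⟨r, hr_mono, hr_lt, hr_tendsto⟩ := exists_seq_strictMono_tendsto δ
  have hunion : Metric.ball x δ ⊆ ⋃ n, Metric.ball x (r n) := fun y hy => by
    obtain ⟨n, hn⟩ := (hr_tendsto.eventually (lt_mem_nhds (Metric.mem_ball.1 hy))).exists
    exact Set.mem_iUnion.2 ⟨n, hn⟩
  have hmono : Monotone fun n => Metric.ball x (r n) := fun m n hmn =>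
    Metric.ball_subset_ball (hr_mono.monotone hmn)
  calc μ (Metric.ball x δ) ≤ μ (⋃ n, Metric.ball x (r n)) := measure_mono hunion
    _ = ⨆ n, μ (Metric.ball x (r n)) := hmono.measure_iUnion
    _ ≤ ⨆ r < δ, μ (Metric.ball x r) :=
      iSup_le fun n => le_iSup₂ (f := fun r (_ : r < δ) => μ (Metric.ball x r)) (r n) (hr_lt n)

section AndersonHilbert

variable {X : Type*} [NormedAddCommGroup X] [InnerProductSpace ℝ X] [CompleteSpace X]
  [SecondCountableTopology X] [MeasurableSpace X] [BorelSpace X]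
  {γ : Measure X} [IsGaussian γ]

lemma measure_closedBall_le_setOf_norm_starProjection_le (h0 : ∫ x, x ∂γ = 0) (V : Submodule ℝ X)
    [FiniteDimensional ℝ V] (u : X) (δ : ℝ) :
    γ (Metric.closedBall u δ) ≤ γ {x | ‖V.starProjection x‖ ≤ δ} := by
  let p : X →L[ℝ] V := V.orthogonalProjectionOnto
  have hp0 : ∫ x, x ∂γ.map p = 0 := by
    rw [integral_map (by fun_prop) (by fun_prop),
      p.integral_comp_comm (φ := fun x => x) IsGaussian.integrable_id, h0, map_zero]
  have hp_le : ∀ x, ‖p x‖ ≤ ‖x‖ := V.norm_orthogonalProjectionOnto_apply_le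
  calc γ (Metric.closedBall u δ) ≤ γ (p ⁻¹' Metric.closedBall (p u) δ) := by
        refine measure_mono fun x hx => ?_
        rw [mem_closedBall_iff_norm] at hx
        rw [Set.mem_preimage, mem_closedBall_iff_norm, ← map_sub]
        exact (hp_le _).trans hx
    _ = γ.map p (Metric.closedBall (p u) δ) :=
        (Measure.map_apply (by fun_prop) Metric.isClosed_closedBall.measurableSet).symm
    _ ≤ γ.map p (Metric.closedBall 0 δ) := measure_closedBall_le_of_finiteDimensional hp0 _ _
    _ = γ {x | ‖V.starProjection x‖ ≤ δ} := by
        rw [Measure.map_apply (by fun_prop) Metric.isClosed_closedBall.measurableSet]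
        congr 1
        ext x
        simp [p]

theorem measure_closedBall_le (h0 : ∫ x, x ∂γ = 0) (u : X) (δ : ℝ) :
    γ (Metric.closedBall u δ) ≤ γ (Metric.closedBall 0 δ) := by
  obtain ⟨V, _, hmono, htend⟩ := exists_monotone_finiteDimensional_tendsto_starProjection X
  have hanti : Antitone fun n => {x | ‖(V n).starProjection x‖ ≤ δ} := fun m n hmn x hx => by
    have hproj : (V m).starProjection x = (V m).starProjection ((V n).starProjection x) := by
      rw [Submodule.starProjection_apply (V m), Submodule.starProjection_apply (V m),
        Submodule.orthogonalProjectionOnto_starProjection_of_le (hmono hmn)]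
    rw [Set.mem_ofPred_eq, hproj]
    exact ((V m).norm_starProjection_apply_le _).trans hx
  have hinter : ⋂ n, {x | ‖(V n).starProjection x‖ ≤ δ} ⊆ Metric.closedBall 0 δ := fun x hx => by
    rw [mem_closedBall_zero_iff]
    exact le_of_tendsto (htend x).norm (Eventually.of_forall fun n => Set.mem_iInter.1 hx n)
  have hlim := tendsto_measure_iInter_atTop (μ := γ)
    (s := fun n => {x | ‖(V n).starProjection x‖ ≤ δ})
    (fun n => (measurableSet_le (by fun_prop) (by fun_prop)).nullMeasurableSet) hanti
    ⟨0, measure_ne_top _ _⟩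
  exact (ge_of_tendsto hlim (Eventually.of_forall fun n =>
    measure_closedBall_le_setOf_norm_starProjection_le h0 (V n) u δ)).trans (measure_mono hinter)

theorem measure_ball_le (h0 : ∫ x, x ∂γ = 0) (u : X) (δ : ℝ) :
    γ (Metric.ball u δ) ≤ γ (Metric.ball 0 δ) := by
  rw [measure_ball_eq_iSup_lt]
  exact iSup₂_le fun r hr => (measure_mono Metric.ball_subset_closedBall).trans
    ((measure_closedBall_le h0 u r).trans (measure_mono (Metric.closedBall_subset_ball hr)))

lemma measure_ball_zero_pos (h0 : ∫ x, x ∂γ = 0) {δ : ℝ} (hδ : 0 < δ) :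
    0 < γ (Metric.ball 0 δ) := by
  by_contra! hzero
  have huniv : γ Set.univ = 0 := measure_null_of_locally_null _ fun x _ =>
    ⟨Metric.ball x δ, mem_nhdsWithin_of_mem_nhds (Metric.ball_mem_nhds x hδ),
      le_antisymm ((measure_ball_le h0 x δ).trans hzero) zero_le⟩
  simp at huniv

end AndersonHilbert

/-! ### Measures of shifted balls -/

section ShiftedBalls

variable {X : Type*} [NormedAddCommGroup X] [InnerProductSpace ℝ X] [MeasurableSpace X]
  [BorelSpace X] {γ : Measure X}

lemma inner_le_toReal_cameronMartinNorm {h : X} (hh : h ∈ cameronMartinSpace γ) {v : X}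
    (hv : covarianceBilin γ v v ≤ 1) : ⟪v, h⟫ ≤ (cameronMartinNorm γ h).toReal :=
  (ENNReal.ofReal_le_iff_le_toReal hh).1
    (le_iSup₂ (f := fun (v : X) (_ : covarianceBilin γ v v ≤ 1) => ENNReal.ofReal ⟪v, h⟫) v hv)

lemma inner_le_toReal_cameronMartinNorm_mul_sqrt {h : X} (hh : h ∈ cameronMartinSpace γ) (v : X) :
    ⟪v, h⟫ ≤ (cameronMartinNorm γ h).toReal * √(covarianceBilin γ v v) := by
  rcases (covarianceBilin_self_nonneg (μ := γ) v).eq_or_lt with hv | hv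
  · rw [← hv, Real.sqrt_zero, mul_zero]
    by_contra! hpos
    have hle := inner_le_toReal_cameronMartinNorm hh
      (v := (((cameronMartinNorm γ h).toReal + 1) / ⟪v, h⟫) • v) (by simp [← hv])
    rw [real_inner_smul_left, div_mul_cancel₀ _ hpos.ne'] at hle
    linarith
  · have hle := inner_le_toReal_cameronMartinNorm hh (v := (√(covarianceBilin γ v v))⁻¹ • v) (by
      simp only [map_smul, smul_apply, smul_eq_mul]
      rw [← mul_assoc, ← mul_inv, Real.mul_self_sqrt hv.le, inv_mul_cancel₀ hv.ne'])
    rwa [real_inner_smul_left, inv_mul_le_iff₀ (Real.sqrt_pos.2 hv), mul_comm] at hle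

lemma cameronMartinNorm_le_of_forall_inner_le {h : X} {R : ℝ}
    (H : ∀ v, ⟪v, h⟫ - covarianceBilin γ v v / 2 ≤ R) :
    cameronMartinNorm γ h ≤ ENNReal.ofReal √(2 * R) := by
  refine iSup₂_le fun v hv => ENNReal.ofReal_le_ofReal (Real.le_sqrt_of_sq_le ?_)
  have hle := H (⟪v, h⟫ • v)
  simp only [real_inner_smul_left, map_smul, smul_apply, smul_eq_mul] at hle
  nlinarith [sq_nonneg ⟪v, h⟫]

lemma convexOn_covarianceBilin_self (γ : Measure X) :
    ConvexOn ℝ Set.univ fun v => covarianceBilin γ v v := by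
  refine ⟨convex_univ, fun v _ w _ a b ha hb hab => ?_⟩
  have hsub : a * covarianceBilin γ v v + b * covarianceBilin γ w w
      - covarianceBilin γ (a • v + b • w) (a • v + b • w)
      = a * b * covarianceBilin γ (v - w) (v - w) := by
    obtain rfl : b = 1 - a := by linarith
    simp only [map_add, map_sub, map_smul, add_apply, sub_apply, smul_apply, smul_eq_mul,
      covarianceBilin_comm w v]
    ring
  have hnonneg := mul_nonneg (mul_nonneg ha hb) (covarianceBilin_self_nonneg (μ := γ) (v - w))
  simp only [smul_eq_mul]
  linarith

lemma mul_sqrt_covarianceBilin_le_of_forall_le {r c : ℝ} {w : X}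
    (H : ∀ v, covarianceBilin γ v v ≤ r ^ 2 → covarianceBilin γ v w ≤ c) :
    r * √(covarianceBilin γ w w) ≤ c := by
  rcases (covarianceBilin_self_nonneg (μ := γ) w).eq_or_lt with hw | hw
  · simpa [← hw] using H 0 (by simpa using sq_nonneg r)
  · have hle := H ((r / √(covarianceBilin γ w w)) • w) (by
      simp only [map_smul, smul_apply, smul_eq_mul]
      rw [← mul_assoc, div_mul_div_comm, Real.mul_self_sqrt hw.le, div_mul_cancel₀ _ hw.ne', sq])
    simp only [map_smul, smul_apply, smul_eq_mul] at hle
    rwa [div_mul_comm, Real.div_sqrt, mul_comm] at hle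

variable [CompleteSpace X] [SecondCountableTopology X] [IsGaussian γ]

/- By Hahn–Banach: the support functions of the two sides of the claim agree. -/
lemma mem_closure_image_covarianceOperator (h0 : ∫ x, x ∂γ = 0) {h : X}
    (hh : h ∈ cameronMartinSpace γ) :
    h ∈ closure (covarianceOperator γ ''
      {v | covarianceBilin γ v v ≤ (cameronMartinNorm γ h).toReal ^ 2}) := by
  have hconv : Convex ℝ {v | covarianceBilin γ v v ≤ (cameronMartinNorm γ h).toReal ^ 2} := by
    simpa using (convexOn_covarianceBilin_self γ).convex_le ((cameronMartinNorm γ h).toReal ^ 2)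
  by_contra hnot
  obtain ⟨f, c, hf, hc⟩ := geometric_hahn_banach_closed_point
    (hconv.linear_image (covarianceOperator γ : X →ₗ[ℝ] X)).closure isClosed_closure hnot
  let w := (InnerProductSpace.toDual ℝ X).symm f
  have hfw : ∀ y, f y = ⟪w, y⟫ := fun y => InnerProductSpace.toDual_symm_apply.symm
  have hwc : (cameronMartinNorm γ h).toReal * √(covarianceBilin γ w w) ≤ c :=
    mul_sqrt_covarianceBilin_le_of_forall_le fun v hv => by
      have hlt := hf _ (subset_closure ⟨v, hv, rfl⟩)
      rw [hfw, real_inner_comm, ContinuousLinearMap.coe_coe, inner_covarianceOperator h0] at hlt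
      exact hlt.le
  have hch := hfw h ▸ hc
  exact (hch.trans_le (inner_le_toReal_cameronMartinNorm_mul_sqrt hh w)).not_ge hwc

lemma measure_ball_eq_setLIntegral_ball_sub (h0 : ∫ x, x ∂γ = 0) (v u : X) (δ : ℝ) :
    γ (Metric.ball u δ) = ∫⁻ x in Metric.ball (u - covarianceOperator γ v) δ,
      ENNReal.ofReal (Real.exp (-⟪v, x⟫ - covarianceBilin γ v v / 2)) ∂γ := by
  have hcm := map_add_covarianceOperator (γ := γ) h0 (-v)
  simp only [map_neg, neg_apply, neg_neg, inner_neg_left] at hcm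
  rw [← withDensity_apply _ Metric.isOpen_ball.measurableSet, ← hcm,
    Measure.map_apply (by fun_prop) Metric.isOpen_ball.measurableSet]
  congr 1
  ext x
  simp [dist_eq_norm, sub_eq_add_neg]

lemma measure_ball_le_exp_mul (h0 : ∫ x, x ∂γ = 0) (v u : X) (δ : ℝ) :
    γ (Metric.ball u δ) ≤ ENNReal.ofReal
      (Real.exp (-(⟪v, u⟫ - covarianceBilin γ v v / 2) + δ * ‖v‖)) * γ (Metric.ball 0 δ) := by
  rw [measure_ball_eq_setLIntegral_ball_sub h0 v]
  calc _ ≤ ∫⁻ _ in Metric.ball (u - covarianceOperator γ v) δ, ENNReal.ofReal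
          (Real.exp (-(⟪v, u⟫ - covarianceBilin γ v v / 2) + δ * ‖v‖)) ∂γ := by
        refine setLIntegral_mono' Metric.isOpen_ball.measurableSet fun x hx => ?_
        gcongr ENNReal.ofReal (Real.exp ?_)
        have hinner := neg_le_of_abs_le ((abs_real_inner_le_norm v _).trans
          (mul_le_mul_of_nonneg_left (mem_ball_iff_norm.1 hx).le (norm_nonneg v)))
        have hvv : ⟪v, covarianceOperator γ v⟫ = covarianceBilin γ v v := by
          rw [real_inner_comm, inner_covarianceOperator h0]
        rw [inner_sub_right, inner_sub_right, hvv] at hinner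
        linarith
    _ ≤ _ := by
        rw [setLIntegral_const]
        exact mul_le_mul_right (measure_ball_le h0 _ _) _

lemma map_neg_eq_self (h0 : ∫ x, x ∂γ = 0) : γ.map (fun x => -x) = γ := by
  have : IsProbabilityMeasure (γ.map fun x => -x) := Measure.isProbabilityMeasure_map (by fun_prop)
  refine Measure.ext_of_charFun (funext fun t => ?_)
  rw [charFun_apply, integral_map (by fun_prop) (by fun_prop)]
  simp_rw [inner_neg_left, ← inner_neg_right]
  rw [← charFun_apply, IsGaussian.charFun_eq', IsGaussian.charFun_eq']
  simp [h0]

lemma measure_ball_neg (h0 : ∫ x, x ∂γ = 0) (u : X) (δ : ℝ) :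
    γ (Metric.ball (-u) δ) = γ (Metric.ball u δ) := by
  conv_lhs => rw [← map_neg_eq_self h0, Measure.map_apply (by fun_prop)
    Metric.isOpen_ball.measurableSet]
  congr 1
  ext x
  simp

/- Averaging the Cameron–Martin formula for `v` and `-v` replaces the factor `exp (-⟪v, x⟫)` by
`cosh ⟪v, x⟫ ≥ 1`. -/
lemma exp_mul_measure_ball_zero_le_covarianceOperator (h0 : ∫ x, x ∂γ = 0) (v : X) (δ : ℝ) :
    ENNReal.ofReal (Real.exp (-(covarianceBilin γ v v / 2))) * γ (Metric.ball 0 δ) ≤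
      γ (Metric.ball (covarianceOperator γ v) δ) := by
  have hball : ∀ w, γ (Metric.ball (covarianceOperator γ w) δ) = ∫⁻ x in Metric.ball 0 δ,
      ENNReal.ofReal (Real.exp (-⟪w, x⟫ - covarianceBilin γ w w / 2)) ∂γ := fun w => by
    simpa using measure_ball_eq_setLIntegral_ball_sub h0 w (covarianceOperator γ w) δ
  have hcosh : ∀ x, 2 * ENNReal.ofReal (Real.exp (-(covarianceBilin γ v v / 2))) ≤
      ENNReal.ofReal (Real.exp (-⟪v, x⟫ - covarianceBilin γ v v / 2)) +
        ENNReal.ofReal (Real.exp (-⟪-v, x⟫ - covarianceBilin γ (-v) (-v) / 2)) := fun x => by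
    rw [← ENNReal.ofReal_add (Real.exp_pos _).le (Real.exp_pos _).le, ← ENNReal.ofReal_ofNat,
      ← ENNReal.ofReal_mul (by norm_num)]
    refine ENNReal.ofReal_le_ofReal ?_
    simp only [inner_neg_left, map_neg, neg_apply, neg_neg, sub_eq_add_neg, Real.exp_add]
    rw [← add_mul]
    gcongr
    linarith [Real.add_one_le_exp ⟪v, x⟫, Real.add_one_le_exp (-⟪v, x⟫)]
  refine (ENNReal.mul_le_mul_iff_right (a := 2) (by norm_num) (by norm_num)).1 ?_
  calc 2 * (ENNReal.ofReal (Real.exp (-(covarianceBilin γ v v / 2))) * γ (Metric.ball 0 δ))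
      = ∫⁻ _ in Metric.ball (0 : X) δ,
          2 * ENNReal.ofReal (Real.exp (-(covarianceBilin γ v v / 2))) ∂γ := by
        rw [setLIntegral_const, mul_assoc]
    _ ≤ ∫⁻ x in Metric.ball (0 : X) δ,
          (ENNReal.ofReal (Real.exp (-⟪v, x⟫ - covarianceBilin γ v v / 2)) +
          ENNReal.ofReal (Real.exp (-⟪-v, x⟫ - covarianceBilin γ (-v) (-v) / 2))) ∂γ :=
        lintegral_mono hcosh
    _ = 2 * γ (Metric.ball (covarianceOperator γ v) δ) := by
        rw [lintegral_add_left (by fun_prop), ← hball, ← hball, map_neg, measure_ball_neg h0,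
          two_mul]

lemma exp_mul_measure_ball_zero_le (h0 : ∫ x, x ∂γ = 0) {h : X} (hh : h ∈ cameronMartinSpace γ)
    (δ : ℝ) :
    ENNReal.ofReal (Real.exp (-(1 / 2 * (cameronMartinNorm γ h).toReal ^ 2))) *
      γ (Metric.ball 0 δ) ≤ γ (Metric.ball h δ) := by
  simp_rw [measure_ball_eq_iSup_lt γ 0 δ, ENNReal.mul_iSup]
  refine iSup₂_le fun r hr => ?_
  obtain ⟨_, ⟨v, hv, rfl⟩, hdist⟩ := Metric.mem_closure_iff.1
    (mem_closure_image_covarianceOperator h0 hh) (δ - r) (sub_pos.2 hr)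
  have hv' : covarianceBilin γ v v ≤ (cameronMartinNorm γ h).toReal ^ 2 := hv
  calc _ ≤ ENNReal.ofReal (Real.exp (-(covarianceBilin γ v v / 2))) * γ (Metric.ball 0 r) := by
        gcongr ENNReal.ofReal (Real.exp ?_) * _
        linarith
    _ ≤ γ (Metric.ball (covarianceOperator γ v) r) :=
        exp_mul_measure_ball_zero_le_covarianceOperator h0 v r
    _ ≤ γ (Metric.ball h δ) := measure_mono (Metric.ball_subset_ball' (by
        rw [dist_comm]
        linarith))

end ShiftedBalls

/-! ### Compactness of almost admissible shifts -/

lemma totallyBounded_range_of_forall_isCompact {X : Type*} [PseudoMetricSpace X] {u : ℕ → X}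
    (h : ∀ ε > 0, ∃ K : Set X, IsCompact K ∧ ∀ᶠ n in atTop, ∃ k ∈ K, dist (u n) k < ε) :
    TotallyBounded (Set.range u) := by
  rw [Metric.totallyBounded_iff]
  intro ε hε
  obtain ⟨K, hK, hKu⟩ := h (ε / 2) (half_pos hε)
  obtain ⟨N, hN⟩ := eventually_atTop.1 hKu
  obtain ⟨t, ht, hcov⟩ := Metric.totallyBounded_iff.1 hK.totallyBounded (ε / 2) (half_pos hε)
  refine ⟨t ∪ u '' Set.Iio N, ht.union ((Set.finite_Iio N).image u), ?_⟩
  rintro _ ⟨n, rfl⟩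
  rcases lt_or_ge n N with hn | hn
  · exact Set.mem_iUnion₂.2 ⟨u n, Or.inr ⟨n, hn, rfl⟩, Metric.mem_ball_self hε⟩
  · obtain ⟨k, hk, hdist⟩ := hN n hn
    obtain ⟨y, hy, hky⟩ := Set.mem_iUnion₂.1 (hcov hk)
    refine Set.mem_iUnion₂.2 ⟨y, Or.inl hy, ?_⟩
    rw [Metric.mem_ball] at hky ⊢
    linarith [dist_triangle (u n) k y]

section Compactness

variable {X : Type*} [NormedAddCommGroup X] [InnerProductSpace ℝ X] [CompleteSpace X]
  [SecondCountableTopology X] [MeasurableSpace X] [BorelSpace X]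
  {γ : Measure X} [IsGaussian γ]

lemma integrable_norm_sub_starProjection_sq (V : Submodule ℝ X) [FiniteDimensional ℝ V] :
    Integrable (fun x => ‖x - V.starProjection x‖ ^ 2) γ :=
  ((IsGaussian.memLp_two_id (μ := γ)).sub
    (IsGaussian.memLp_two_id.continuousLinearMap_comp V.starProjection)).integrable_norm_pow
      two_ne_zero

lemma covarianceBilin_self_le_of_mem_orthogonal (h0 : ∫ x, x ∂γ = 0) (V : Submodule ℝ X)
    [FiniteDimensional ℝ V] {w : X} (hw : w ∈ Vᗮ) :
    covarianceBilin γ w w ≤ ‖w‖ ^ 2 * ∫ x, ‖x - V.starProjection x‖ ^ 2 ∂γ := by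
  have hinner : ∀ x, ⟪w, x⟫ = ⟪w, x - V.starProjection x⟫ := fun x => by
    rw [inner_sub_right, Submodule.inner_left_of_mem_orthogonal (V.starProjection_apply_mem x) hw,
      sub_zero]
  rw [covarianceBilin_apply IsGaussian.memLp_two_id, ← integral_const_mul]
  simp only [id_eq, h0, sub_zero]
  refine integral_mono_of_nonneg (ae_of_all _ fun x => mul_self_nonneg _)
    ((integrable_norm_sub_starProjection_sq V).const_mul _) (ae_of_all _ fun x => ?_)
  simp only [← sq, ← mul_pow, hinner x]
  exact sq_le_sq' (abs_le.1 (abs_real_inner_le_norm _ _)).1 (real_inner_le_norm _ _)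

/- Test the hypothesis with the multiple of norm `s` of the part of `u` orthogonal to `V`. -/
lemma norm_sub_starProjection_le (h0 : ∫ x, x ∂γ = 0) (V : Submodule ℝ X) [FiniteDimensional ℝ V]
    {u : X} {R δ : ℝ} (hδ : 0 ≤ δ)
    (H : ∀ v, ⟪v, u⟫ ≤ R + covarianceBilin γ v v / 2 + δ * ‖v‖) {s : ℝ} (hs : 0 < s) :
    ‖u - V.starProjection u‖ ≤ R / s + s * (∫ x, ‖x - V.starProjection x‖ ^ 2 ∂γ) / 2 + δ := by
  set z := u - V.starProjection u with hz
  set κ := ∫ x, ‖x - V.starProjection x‖ ^ 2 ∂γ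
  have hR : 0 ≤ R := by simpa using H 0
  have : 0 ≤ κ := integral_nonneg fun x => by positivity
  rcases eq_or_ne z 0 with hz0 | hz0
  · rw [hz0, norm_zero]; positivity
  have hzpos : 0 < ‖z‖ := norm_pos_iff.2 hz0
  have hzV : z ∈ Vᗮ := V.sub_starProjection_mem_orthogonal u
  have hzu : ⟪z, u⟫ = ‖z‖ ^ 2 := by
    rw [← real_inner_self_eq_norm_sq]
    nth_rw 3 [hz]
    rw [inner_sub_right, Submodule.inner_left_of_mem_orthogonal (V.starProjection_apply_mem u) hzV,
      sub_zero]
  have hle := H ((s / ‖z‖) • z)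
  have hcov := covarianceBilin_self_le_of_mem_orthogonal h0 V
    (Vᗮ.smul_mem (s / ‖z‖) hzV)
  have hnorm : ‖(s / ‖z‖) • z‖ = s := by
    rw [norm_smul, Real.norm_of_nonneg (by positivity), div_mul_cancel₀ _ hzpos.ne']
  have hinner : ⟪(s / ‖z‖) • z, u⟫ = s * ‖z‖ := by
    rw [real_inner_smul_left, hzu]; field_simp
  rw [hnorm] at hle hcov
  have hmul : s * ‖z‖ ≤ s * (R / s + s * κ / 2 + δ) := by
    calc s * ‖z‖ ≤ R + s ^ 2 * κ / 2 + δ * s := by linarith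
      _ = s * (R / s + s * κ / 2 + δ) := by field_simp
  exact le_of_mul_le_mul_left hmul hs

lemma tendsto_integral_norm_sub_starProjection_sq {V : ℕ → Submodule ℝ X}
    [∀ n, FiniteDimensional ℝ (V n)]
    (hV : ∀ x, Tendsto (fun n => (V n).starProjection x) atTop (𝓝 x)) :
    Tendsto (fun n => ∫ x, ‖x - (V n).starProjection x‖ ^ 2 ∂γ) atTop (𝓝 0) := by
  rw [← integral_zero X ℝ (μ := γ)]
  refine tendsto_integral_of_dominated_convergence (fun x => ‖x‖ ^ 2)
    (fun n => Continuous.aestronglyMeasurable (by fun_prop))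
    (IsGaussian.memLp_two_id.integrable_norm_pow two_ne_zero)
    (fun n => ae_of_all _ fun x => ?_) (ae_of_all _ fun x => ?_)
  · rw [Real.norm_of_nonneg (by positivity), (V n).norm_sq_eq_add_norm_sq_starProjection x,
      Submodule.starProjection_orthogonal_val]
    exact le_add_of_nonneg_left (by positivity)
  · simpa using ((tendsto_const_nhds (x := x)).sub (hV x)).norm.pow 2

lemma totallyBounded_range_of_inner_le (h0 : ∫ x, x ∂γ = 0) {u : ℕ → X} {δ : ℕ → ℝ} {R : ℝ}
    (hδ : ∀ n, 0 ≤ δ n) (hδ0 : Tendsto δ atTop (𝓝 0))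
    (H : ∀ n v, ⟪v, u n⟫ ≤ R + covarianceBilin γ v v / 2 + δ n * ‖v‖) :
    TotallyBounded (Set.range u) := by
  have hR : 0 ≤ R := by simpa using H 0 0
  obtain ⟨B, hB⟩ : ∃ B, ∀ n, ‖u n‖ ≤ B := by
    obtain ⟨D, hD⟩ := hδ0.bddAbove_range
    refine ⟨R + (∫ x, ‖x‖ ^ 2 ∂γ) / 2 + D, fun n => ?_⟩
    have hle := norm_sub_starProjection_le h0 ⊥ (hδ n) (H n) one_pos
    simp only [Submodule.starProjection_bot, zero_apply, sub_zero, div_one, one_mul] at hle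
    linarith [hD ⟨n, rfl⟩]
  obtain ⟨V, _, -, hV⟩ := exists_monotone_finiteDimensional_tendsto_starProjection X
  refine totallyBounded_range_of_forall_isCompact fun ε hε => ?_
  obtain ⟨s, hs, hRs⟩ : ∃ s > 0, R / s < ε / 4 := by
    refine ⟨4 * (R + 1) / ε, by positivity, ?_⟩
    rw [div_div_eq_mul_div, div_lt_div_iff₀ (by positivity) (by norm_num)]
    nlinarith
  obtain ⟨N, hN⟩ := ((tendsto_integral_norm_sub_starProjection_sq (γ := γ) hV).const_mul
    s |>.eventually_lt_const (show s * 0 < ε / 2 by simpa using half_pos hε)).exists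
  refine ⟨(V N).subtypeL '' Metric.closedBall 0 B,
    (isCompact_closedBall _ _).image (V N).subtypeL.continuous, ?_⟩
  filter_upwards [hδ0.eventually_lt_const (show 0 < ε / 4 by positivity)] with n hn
  refine ⟨(V N).starProjection (u n), ⟨(V N).orthogonalProjectionOnto (u n), ?_, rfl⟩, ?_⟩
  · exact mem_closedBall_zero_iff.2
      (((V N).norm_orthogonalProjectionOnto_apply_le _).trans (hB n))
  · rw [dist_eq_norm]
    linarith [norm_sub_starProjection_le h0 (V N) (hδ n) (H n) hs]

end Compactness

/-! ### Balls of a general Gaussian measure -/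

section Translation

variable {X : Type*} [NormedAddCommGroup X] [InnerProductSpace ℝ X] [MeasurableSpace X]
  [BorelSpace X] (μ : Measure X)

lemma map_sub_mean_ball (z : X) (δ : ℝ) :
    (μ.map fun x => x - ∫ u, u ∂μ) (Metric.ball (z - ∫ u, u ∂μ) δ) = μ (Metric.ball z δ) := by
  rw [Measure.map_apply (by fun_prop) Metric.isOpen_ball.measurableSet]
  congr 1
  ext x
  simp

lemma map_sub_mean_ball_zero (δ : ℝ) :
    (μ.map fun x => x - ∫ u, u ∂μ) (Metric.ball 0 δ) = μ (Metric.ball (∫ u, u ∂μ) δ) := by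
  rw [← map_sub_mean_ball μ, sub_self]

variable [CompleteSpace X] [IsGaussian μ]

lemma covarianceBilin_map_sub_mean :
    covarianceBilin (μ.map fun x => x - ∫ u, u ∂μ) = covarianceBilin μ := by
  simp_rw [sub_eq_neg_add]
  exact covarianceBilin_map_const_add _

lemma cameronMartinNorm_map_sub_mean :
    cameronMartinNorm (μ.map fun x => x - ∫ u, u ∂μ) = cameronMartinNorm μ := by
  ext h
  simp only [cameronMartinNorm, covarianceBilin_map_sub_mean]

variable [SecondCountableTopology X]

lemma integral_map_sub_mean : ∫ x, x ∂(μ.map fun x => x - ∫ u, u ∂μ) = 0 := by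
  rw [integral_map (by fun_prop) (by fun_prop), integral_sub (f := fun x => x)
    IsGaussian.integrable_id (integrable_const _)]
  simp

lemma measure_ball_le_exp_mul_measure_ball_mean (v u : X) (δ : ℝ) :
    μ (Metric.ball u δ) ≤ ENNReal.ofReal
      (Real.exp (-(⟪v, u - ∫ u, u ∂μ⟫ - covarianceBilin μ v v / 2) + δ * ‖v‖)) *
        μ (Metric.ball (∫ u, u ∂μ) δ) := by
  rw [← map_sub_mean_ball μ, ← map_sub_mean_ball_zero μ, ← covarianceBilin_map_sub_mean μ]
  exact measure_ball_le_exp_mul (integral_map_sub_mean μ) v _ δ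

lemma exp_mul_measure_ball_mean_le {h : X} (hh : h - ∫ u, u ∂μ ∈ cameronMartinSpace μ) (δ : ℝ) :
    ENNReal.ofReal (Real.exp (-(1 / 2 * (cameronMartinNorm μ (h - ∫ u, u ∂μ)).toReal ^ 2))) *
      μ (Metric.ball (∫ u, u ∂μ) δ) ≤ μ (Metric.ball h δ) := by
  rw [← map_sub_mean_ball_zero μ, ← map_sub_mean_ball μ h, ← cameronMartinNorm_map_sub_mean μ]
  refine exp_mul_measure_ball_zero_le (integral_map_sub_mean μ) ?_ δ
  rwa [cameronMartinSpace, cameronMartinNorm_map_sub_mean μ]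

lemma measure_ball_mean_pos {δ : ℝ} (hδ : 0 < δ) : 0 < μ (Metric.ball (∫ u, u ∂μ) δ) := by
  rw [← map_sub_mean_ball_zero μ]
  exact measure_ball_zero_pos (integral_map_sub_mean μ) hδ

lemma eventually_measure_ball_mean_ne :
    ∀ᶠ r in 𝓝[>] 0, μ (Metric.ball (∫ u, u ∂μ) r) ≠ 0 ∧ μ (Metric.ball (∫ u, u ∂μ) r) ≠ ∞ := by
  filter_upwards [self_mem_nhdsWithin] with r hr
  exact ⟨(measure_ball_mean_pos μ hr).ne', measure_ne_top _ _⟩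

lemma exists_tendsto_subseq_of_inner_sub_mean_le {u : ℕ → X} {δ : ℕ → ℝ} {R : ℝ}
    (hδ : ∀ n, 0 ≤ δ n) (hδ0 : Tendsto δ atTop (𝓝 0))
    (H : ∀ n v, ⟪v, u n - ∫ u, u ∂μ⟫ ≤ R + covarianceBilin μ v v / 2 + δ n * ‖v‖) :
    ∃ a, ∃ φ : ℕ → ℕ, StrictMono φ ∧ Tendsto (u ∘ φ) atTop (𝓝 a) := by
  rw [← covarianceBilin_map_sub_mean μ] at H
  have hcompact := (totallyBounded_range_of_inner_le (integral_map_sub_mean μ) hδ hδ0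
    H).closure.isCompact_of_isClosed isClosed_closure
  obtain ⟨a, -, φ, hφ, ha⟩ := hcompact.tendsto_subseq fun n => subset_closure ⟨n, rfl⟩
  exact ⟨a + ∫ u, u ∂μ, φ, hφ, (ha.add_const (∫ u, u ∂μ)).congr fun n => by simp⟩

end Translation

/-! ### Small balls of Gibbs measures and MAP estimators -/

section OnsagerMachlup

variable {X : Type*} [NormedAddCommGroup X] [InnerProductSpace ℝ X] [MeasurableSpace X]
  [BorelSpace X] {μ : Measure X} {Ψ : X → ℝ}

lemma onsagerMachlup_of_mem {z : X} (hz : z - ∫ u, u ∂μ ∈ cameronMartinSpace μ) :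
    onsagerMachlup μ Ψ z =
      ((Ψ z + 1 / 2 * (cameronMartinNorm μ (z - ∫ u, u ∂μ)).toReal ^ 2 : ℝ) : EReal) :=
  if_pos hz

lemma onsagerMachlup_lt_top_iff {z : X} :
    onsagerMachlup μ Ψ z < ⊤ ↔ z - ∫ u, u ∂μ ∈ cameronMartinSpace μ := by
  rw [onsagerMachlup]
  split_ifs with hz
  · exact iff_of_true (EReal.coe_lt_top _) hz
  · exact iff_of_false (lt_irrefl ⊤) hz

lemma onsagerMachlup_mean_lt_top : onsagerMachlup μ Ψ (∫ u, u ∂μ) < ⊤ := by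
  simp [onsagerMachlup_lt_top_iff, cameronMartinSpace, cameronMartinNorm]

lemma exists_lt_of_lt_onsagerMachlup {z : X} {b : ℝ} (hb : (b : EReal) < onsagerMachlup μ Ψ z) :
    ∃ v, b < Ψ z + (⟪v, z - ∫ u, u ∂μ⟫ - covarianceBilin μ v v / 2) := by
  by_contra! hle
  have hnorm := cameronMartinNorm_le_of_forall_inner_le (γ := μ) (h := z - ∫ u, u ∂μ)
    (R := b - Ψ z) fun v => by linarith [hle v]
  have hR : 0 ≤ b - Ψ z := by simpa using hle 0
  have hsq := pow_le_pow_left₀ ENNReal.toReal_nonneg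
    (ENNReal.toReal_mono ENNReal.ofReal_ne_top hnorm) 2
  rw [ENNReal.toReal_ofReal (Real.sqrt_nonneg _), Real.sq_sqrt (by positivity)] at hsq
  rw [onsagerMachlup_of_mem (ne_top_of_le_ne_top ENNReal.ofReal_ne_top hnorm),
    EReal.coe_lt_coe_iff] at hb
  linarith

end OnsagerMachlup

/-- The measure with density `exp (-Ψ)` with respect to `μ`, not normalised: the posterior with
potential `Ψ` is a multiple of it, and multiples have the same MAP estimators. -/
noncomputable def gibbsMeasure {X : Type*} [MeasurableSpace X] (μ : Measure X) (Ψ : X → ℝ) :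
    Measure X :=
  μ.withDensity fun x => ENNReal.ofReal (Real.exp (-Ψ x))

lemma gibbsMeasure_apply_le {X : Type*} [MeasurableSpace X] {μ : Measure X} {Ψ : X → ℝ}
    {s : Set X} (hs : MeasurableSet s) {c : ℝ} (h : ∀ x ∈ s, c ≤ Ψ x) :
    gibbsMeasure μ Ψ s ≤ ENNReal.ofReal (Real.exp (-c)) * μ s := by
  rw [gibbsMeasure, withDensity_apply _ hs, ← setLIntegral_const]
  exact setLIntegral_mono' hs fun x hx =>
    ENNReal.ofReal_le_ofReal (Real.exp_le_exp.2 (neg_le_neg (h x hx)))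

lemma le_gibbsMeasure_apply {X : Type*} [MeasurableSpace X] {μ : Measure X} {Ψ : X → ℝ}
    {s : Set X} (hs : MeasurableSet s) {c : ℝ} (h : ∀ x ∈ s, Ψ x ≤ c) :
    ENNReal.ofReal (Real.exp (-c)) * μ s ≤ gibbsMeasure μ Ψ s := by
  rw [gibbsMeasure, withDensity_apply _ hs, ← setLIntegral_const]
  exact setLIntegral_mono' hs fun x hx =>
    ENNReal.ofReal_le_ofReal (Real.exp_le_exp.2 (neg_le_neg (h x hx)))

section SmallBalls

variable {X : Type*} [NormedAddCommGroup X] [InnerProductSpace ℝ X] [CompleteSpace X]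
  [SecondCountableTopology X] [MeasurableSpace X] [BorelSpace X]
  {μ : Measure X} [IsGaussian μ] {Ψ : X → ℝ}

lemma gibbsMeasure_ball_le {u : X} {δ c : ℝ} (h : ∀ x ∈ Metric.ball u δ, c ≤ Ψ x) (v : X) :
    gibbsMeasure μ Ψ (Metric.ball u δ) ≤ ENNReal.ofReal (Real.exp
      (-(c + (⟪v, u - ∫ u, u ∂μ⟫ - covarianceBilin μ v v / 2) - δ * ‖v‖))) *
        μ (Metric.ball (∫ u, u ∂μ) δ) := by
  calc gibbsMeasure μ Ψ (Metric.ball u δ)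
      ≤ ENNReal.ofReal (Real.exp (-c)) * μ (Metric.ball u δ) :=
        gibbsMeasure_apply_le Metric.isOpen_ball.measurableSet h
    _ ≤ ENNReal.ofReal (Real.exp (-c)) * (ENNReal.ofReal (Real.exp
          (-(⟪v, u - ∫ u, u ∂μ⟫ - covarianceBilin μ v v / 2) + δ * ‖v‖)) *
            μ (Metric.ball (∫ u, u ∂μ) δ)) := by
        gcongr
        exact measure_ball_le_exp_mul_measure_ball_mean μ v u δ
    _ = _ := by
        rw [← mul_assoc, ← ENNReal.ofReal_mul (Real.exp_pos _).le, ← Real.exp_add]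
        congr 3
        ring

lemma eventually_gibbsMeasure_ball_le (hΨ : Continuous Ψ) {z : X} {b : ℝ}
    (hb : (b : EReal) < onsagerMachlup μ Ψ z) :
    ∀ᶠ p : ℝ × X in 𝓝 0 ×ˢ 𝓝 z, gibbsMeasure μ Ψ (Metric.ball p.2 p.1) ≤
      ENNReal.ofReal (Real.exp (-b)) * μ (Metric.ball (∫ u, u ∂μ) p.1) := by
  obtain ⟨v, hv⟩ := exists_lt_of_lt_onsagerMachlup hb
  obtain ⟨c, hc, hcz⟩ := exists_between (sub_lt_iff_lt_add.2 hv)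
  rw [sub_lt_iff_lt_add] at hc
  obtain ⟨ρ, hρ, hball⟩ := Metric.eventually_nhds_iff.1
    (hΨ.continuousAt.eventually (lt_mem_nhds hcz))
  rw [← nhds_prod_eq]
  have hsub : ∀ᶠ p : ℝ × X in 𝓝 (0, z), p.1 + dist p.2 z < ρ :=
    (Continuous.tendsto (by fun_prop) ((0 : ℝ), z)).eventually (gt_mem_nhds (by simpa using hρ))
  have hexp : ∀ᶠ p : ℝ × X in 𝓝 (0, z),
      b < c + (⟪v, p.2 - ∫ u, u ∂μ⟫ - covarianceBilin μ v v / 2) - p.1 * ‖v‖ :=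
    (Continuous.tendsto (by fun_prop) ((0 : ℝ), z)).eventually (lt_mem_nhds (by simpa using hc))
  filter_upwards [hsub, hexp] with p hp hbp
  refine (gibbsMeasure_ball_le (c := c) (fun x hx => ?_) v).trans ?_
  · exact (hball (by linarith [dist_triangle x p.2 z, Metric.mem_ball.1 hx])).le
  · gcongr

lemma eventually_le_gibbsMeasure_ball (hΨ : Continuous Ψ) {z : X} {b : ℝ}
    (hb : onsagerMachlup μ Ψ z < b) :
    ∀ᶠ r : ℝ in 𝓝 0, ENNReal.ofReal (Real.exp (-b)) * μ (Metric.ball (∫ u, u ∂μ) r) ≤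
      gibbsMeasure μ Ψ (Metric.ball z r) := by
  have hz := onsagerMachlup_lt_top_iff.1 (hb.trans (EReal.coe_lt_top b))
  rw [onsagerMachlup_of_mem hz, EReal.coe_lt_coe_iff] at hb
  set N := 1 / 2 * (cameronMartinNorm μ (z - ∫ u, u ∂μ)).toReal ^ 2
  obtain ⟨ρ, hρ, hball⟩ := Metric.eventually_nhds_iff.1
    (hΨ.continuousAt.eventually (gt_mem_nhds (lt_sub_iff_add_lt.2 hb)))
  filter_upwards [gt_mem_nhds hρ] with r hr
  calc ENNReal.ofReal (Real.exp (-b)) * μ (Metric.ball (∫ u, u ∂μ) r)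
      = ENNReal.ofReal (Real.exp (-(b - N))) *
          (ENNReal.ofReal (Real.exp (-N)) * μ (Metric.ball (∫ u, u ∂μ) r)) := by
        rw [← mul_assoc, ← ENNReal.ofReal_mul (Real.exp_pos _).le, ← Real.exp_add]
        congr 4
        ring
    _ ≤ ENNReal.ofReal (Real.exp (-(b - N))) * μ (Metric.ball z r) := by
        gcongr
        exact exp_mul_measure_ball_mean_le μ hz r
    _ ≤ gibbsMeasure μ Ψ (Metric.ball z r) :=
        le_gibbsMeasure_apply Metric.isOpen_ball.measurableSet fun x hx =>
          (hball ((Metric.mem_ball.1 hx).trans hr)).le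

/- Centres violating the bound at radii tending to zero are almost admissible shifts, hence
accumulate at some `z`, where the bound holds locally uniformly. -/
lemma eventually_forall_gibbsMeasure_ball_le (hΨ : Continuous Ψ) {M b : ℝ} (hM : ∀ u, M ≤ Ψ u)
    (hb : ∀ u, (b : EReal) < onsagerMachlup μ Ψ u) :
    ∀ᶠ r : ℝ in 𝓝[>] 0, ∀ u, gibbsMeasure μ Ψ (Metric.ball u r) ≤
      ENNReal.ofReal (Real.exp (-b)) * μ (Metric.ball (∫ u, u ∂μ) r) := by
  by_contra hcon
  obtain ⟨δ, hδ, hviol⟩ := exists_seq_forall_of_frequently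
    ((not_eventually.1 hcon).and_eventually self_mem_nhdsWithin)
  have hδ0 : Tendsto δ atTop (𝓝 0) := hδ.mono_right nhdsWithin_le_nhds
  choose u hu using fun n => not_forall.1 (hviol n).1
  obtain ⟨z, φ, hφ, hz⟩ := exists_tendsto_subseq_of_inner_sub_mean_le μ (u := u)
    (R := b - M) (fun n => (hviol n).2.le) hδ0 fun n v => by
      by_contra! hlt
      refine hu n ((gibbsMeasure_ball_le (c := M) (fun x _ => hM x) v).trans ?_)
      gcongr
      linarith
  obtain ⟨n, hn⟩ := (((hδ0.comp hφ.tendsto_atTop).prodMk hz).eventually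
    (eventually_gibbsMeasure_ball_le hΨ (hb z))).exists
  exact hu (φ n) hn

end SmallBalls

section MAPCriteria

variable {X : Type*} [NormedAddCommGroup X] [MeasurableSpace X] {ν : Measure X} {z : X}
  {g : ℝ → ℝ≥0∞}

lemma isMAPEstimator_smul_iff {c : ℝ≥0∞} (hc0 : c ≠ 0) (hc : c ≠ ∞) :
    IsMAPEstimator (c • ν) z ↔ IsMAPEstimator ν z := by
  simp only [IsMAPEstimator, Measure.smul_apply, smul_eq_mul, ← ENNReal.mul_iSup,
    ENNReal.mul_div_mul_left _ _ hc0 hc]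

lemma ofReal_exp_mul_div_ofReal_exp_mul (a b : ℝ) {m : ℝ≥0∞} (hm0 : m ≠ 0) (hm : m ≠ ∞) :
    ENNReal.ofReal (Real.exp a) * m / (ENNReal.ofReal (Real.exp b) * m) =
      ENNReal.ofReal (Real.exp (a - b)) := by
  rw [ENNReal.mul_div_mul_right _ _ hm0 hm, ← ENNReal.ofReal_div_of_pos (Real.exp_pos _),
    ← Real.exp_sub]

lemma IsMAPEstimator.le_of_eventually_measure_ball_le (hz : IsMAPEstimator ν z)
    (hg : ∀ᶠ r in 𝓝[>] 0, g r ≠ 0 ∧ g r ≠ ∞) {w : X} {a b : ℝ}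
    (hupper : ∀ᶠ r in 𝓝[>] 0, ν (Metric.ball z r) ≤ ENNReal.ofReal (Real.exp (-a)) * g r)
    (hlower : ∀ᶠ r in 𝓝[>] 0, ENNReal.ofReal (Real.exp (-b)) * g r ≤ ν (Metric.ball w r)) :
    a ≤ b := by
  have hone : 1 ≤ ENNReal.ofReal (Real.exp (-a - -b)) := by
    refine le_of_tendsto hz ?_
    filter_upwards [hg, hupper, hlower] with r ⟨hg0, hgtop⟩ hur hlr
    rw [← ofReal_exp_mul_div_ofReal_exp_mul _ _ hg0 hgtop]
    exact ENNReal.div_le_div hur (hlr.trans (le_iSup (fun u => ν (Metric.ball u r)) w))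
  rw [ENNReal.one_le_ofReal, Real.one_le_exp_iff] at hone
  linarith

lemma isMAPEstimator_of_eventually_measure_ball_le
    (hg : ∀ᶠ r in 𝓝[>] 0, g r ≠ 0 ∧ g r ≠ ∞) {a : ℝ}
    (hupper : ∀ b < a, ∀ᶠ r in 𝓝[>] 0, ∀ u,
      ν (Metric.ball u r) ≤ ENNReal.ofReal (Real.exp (-b)) * g r)
    (hlower : ∀ b > a, ∀ᶠ r in 𝓝[>] 0,
      ENNReal.ofReal (Real.exp (-b)) * g r ≤ ν (Metric.ball z r)) :
    IsMAPEstimator ν z := by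
  refine tendsto_order.2 ⟨fun t ht => ?_, fun t ht => Eventually.of_forall fun r => ?_⟩
  · have hlim : Tendsto (fun s : ℝ => ENNReal.ofReal (Real.exp (-(a + s) - -(a - s))))
        (𝓝[>] 0) (𝓝 1) := by
      refine Tendsto.mono_left ?_ nhdsWithin_le_nhds
      have hcont : Continuous fun s : ℝ => ENNReal.ofReal (Real.exp (-(a + s) - -(a - s))) :=
        ENNReal.continuous_ofReal.comp (by fun_prop)
      simpa using hcont.tendsto 0
    obtain ⟨s, hts, hs : 0 < s⟩ := ((hlim.eventually_const_lt ht).and self_mem_nhdsWithin).exists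
    filter_upwards [hg, hupper (a - s) (by linarith), hlower (a + s) (by linarith)]
      with r ⟨hg0, hgtop⟩ hur hlr
    rw [← ofReal_exp_mul_div_ofReal_exp_mul _ _ hg0 hgtop] at hts
    exact hts.trans_le (ENNReal.div_le_div hlr (iSup_le hur))
  · refine lt_of_le_of_lt (ENNReal.div_le_of_le_mul ?_) ht
    rw [one_mul]
    exact le_iSup (fun u => ν (Metric.ball u r)) z

end MAPCriteria

lemma posterior_eq_smul_gibbsMeasure {X : Type*} [MeasurableSpace X] {μ : Measure X} {Φ : X → ℝ}
    (hZ : 0 < ∫ u, Real.exp (-Φ u) ∂μ) :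
    posterior μ Φ = (ENNReal.ofReal (∫ u, Real.exp (-Φ u) ∂μ))⁻¹ • gibbsMeasure μ Φ := by
  rw [gibbsMeasure, ← withDensity_smul' _ _
    (ENNReal.inv_ne_top.2 (ENNReal.ofReal_pos.2 hZ).ne'), posterior]
  congr with x
  rw [ENNReal.ofReal_div_of_pos hZ, Pi.smul_apply, smul_eq_mul, ENNReal.div_eq_inv_mul]

section Posterior

variable {X : Type*} [NormedAddCommGroup X] [MeasurableSpace X] {μ : Measure X} {Φ : X → ℝ}

lemma isMAPEstimator_posterior_iff [NeZero μ]
    (hint : Integrable (fun u => Real.exp (-Φ u)) μ) {z : X} :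
    IsMAPEstimator (posterior μ Φ) z ↔ IsMAPEstimator (gibbsMeasure μ Φ) z := by
  have hZ := integral_exp_pos hint
  rw [posterior_eq_smul_gibbsMeasure hZ]
  exact isMAPEstimator_smul_iff (ENNReal.inv_ne_zero.2 ENNReal.ofReal_ne_top)
    (ENNReal.inv_ne_top.2 (ENNReal.ofReal_pos.2 hZ).ne')

variable [BorelSpace X]

lemma integrable_exp_neg_of_forall_le [IsFiniteMeasure μ] (hΦ : Continuous Φ)
    {M : ℝ} (hM : ∀ u, M ≤ Φ u) : Integrable (fun u => Real.exp (-Φ u)) μ := by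
  refine Integrable.of_bound (C := Real.exp (-M)) ?_ (ae_of_all _ fun u => ?_)
  · exact (by fun_prop : Measurable fun u => Real.exp (-Φ u)).aestronglyMeasurable
  · rw [Real.norm_of_nonneg (Real.exp_pos _).le]
    exact Real.exp_le_exp.2 (neg_le_neg (hM u))

variable [InnerProductSpace ℝ X]

lemma sub_mean_mem_cameronMartinSpace_of_forall_le {z : X}
    (hz : ∀ u, onsagerMachlup μ Φ z ≤ onsagerMachlup μ Φ u) :
    z - ∫ u, u ∂μ ∈ cameronMartinSpace μ :=
  onsagerMachlup_lt_top_iff.1 ((hz _).trans_lt onsagerMachlup_mean_lt_top)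

variable [CompleteSpace X] [SecondCountableTopology X] [IsGaussian μ]

theorem IsMAPEstimator.onsagerMachlup_le (hΦ : Continuous Φ) {z : X}
    (hz : IsMAPEstimator (gibbsMeasure μ Φ) z) (w : X) :
    onsagerMachlup μ Φ z ≤ onsagerMachlup μ Φ w := by
  by_contra! hlt
  obtain ⟨b, hwb, hbz⟩ := EReal.lt_iff_exists_real_btwn.1 hlt
  obtain ⟨a, hba, haz⟩ := EReal.lt_iff_exists_real_btwn.1 hbz
  have hupper := (tendsto_id.prodMk tendsto_const_nhds).eventually
    (eventually_gibbsMeasure_ball_le hΦ haz)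
  have hlower := eventually_le_gibbsMeasure_ball hΦ hwb
  exact (EReal.coe_lt_coe_iff.1 hba).not_ge <|
    hz.le_of_eventually_measure_ball_le (eventually_measure_ball_mean_ne μ)
      (hupper.filter_mono nhdsWithin_le_nhds) (hlower.filter_mono nhdsWithin_le_nhds)

theorem isMAPEstimator_gibbsMeasure_of_forall_le (hΦ : Continuous Φ) {M : ℝ} (hM : ∀ u, M ≤ Φ u)
    {z : X} (hz : ∀ u, onsagerMachlup μ Φ z ≤ onsagerMachlup μ Φ u) :
    IsMAPEstimator (gibbsMeasure μ Φ) z := by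
  have hval := onsagerMachlup_of_mem (Ψ := Φ) (sub_mean_mem_cameronMartinSpace_of_forall_le hz)
  rw [hval] at hz
  refine isMAPEstimator_of_eventually_measure_ball_le (eventually_measure_ball_mean_ne μ)
    (fun b hb => eventually_forall_gibbsMeasure_ball_le hΦ hM fun u =>
      (EReal.coe_lt_coe_iff.2 hb).trans_le (hz u))
    (fun b hb => (eventually_le_gibbsMeasure_ball hΦ ?_).filter_mono nhdsWithin_le_nhds)
  rw [hval]
  exact EReal.coe_lt_coe_iff.2 hb

end Posterior

/-! ### Bayes' formula -/

section Disintegration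

variable {α β : Type*} [MeasurableSpace α] [MeasurableSpace β] {μ : Measure α} {ν : Measure β}
  {f : α × β → ℝ≥0∞}

lemma lintegral_smul_withDensity_div {g : β → ℝ≥0∞} (hg : Measurable g) (hfin : ∫⁻ b, g b ∂ν ≠ ∞) :
    (∫⁻ b, g b ∂ν) • ν.withDensity (fun b => g b / ∫⁻ b, g b ∂ν) = ν.withDensity g := by
  rw [← withDensity_smul _ (hg.div_const _)]
  refine withDensity_congr_ae ?_
  rcases eq_or_ne (∫⁻ b, g b ∂ν) 0 with hzero | hpos
  · filter_upwards [(lintegral_eq_zero_iff hg).1 hzero] with b hb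
    simp [hzero, hb]
  · exact ae_of_all _ fun b => ENNReal.mul_div_cancel hpos hfin

variable [SFinite μ] [SFinite ν]

lemma withDensity_compProd_eq_withDensity_prod {F : α → ℝ≥0∞} (hF : Measurable F)
    (hf : Measurable f) {κ : Kernel α β} [IsSFiniteKernel κ]
    (h : ∀ᵐ a ∂μ, F a • κ a = ν.withDensity fun b => f (a, b)) :
    μ.withDensity F ⊗ₘ κ = (μ.prod ν).withDensity f := by
  ext s hs
  rw [Measure.compProd_apply hs, withDensity_apply _ hs, ← lintegral_indicator hs,
    lintegral_prod _ (hf.indicator hs).aemeasurable,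
    lintegral_withDensity_eq_lintegral_mul _ hF (Kernel.measurable_kernel_prodMk_left hs)]
  refine lintegral_congr_ae ?_
  filter_upwards [h] with a ha
  rw [Pi.mul_apply, ← smul_eq_mul, ← Measure.smul_apply, ha,
    withDensity_apply _ (measurable_prodMk_left hs),
    ← lintegral_indicator (measurable_prodMk_left hs)]
  rfl

lemma map_swap_withDensity_prod (hf : Measurable f) :
    ((μ.prod ν).withDensity f).map Prod.swap =
      (ν.prod μ).withDensity fun p => f p.swap := by
  ext s hs
  rw [Measure.map_apply measurable_swap hs, withDensity_apply _ (measurable_swap hs),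
    withDensity_apply _ hs, ← Measure.prod_swap,
    setLIntegral_map (measurable_swap hs) hf measurable_swap]
  rfl

lemma fst_withDensity_prod (hf : Measurable f) :
    ((μ.prod ν).withDensity f).fst = μ.withDensity fun a => ∫⁻ b, f (a, b) ∂ν := by
  ext s hs
  rw [Measure.fst_apply hs, withDensity_apply _ (measurable_fst hs), withDensity_apply _ hs,
    ← Set.prod_univ, ← Measure.prod_restrict, Measure.restrict_univ,
    lintegral_prod _ hf.aemeasurable]

end Disintegration

section ConditionalLaw

variable {X Y Ω : Type*} [MeasurableSpace X] [MeasurableSpace Y] [MeasurableSpace Ω]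
  {P : Measure Ω} {x : Ω → X} {y : Ω → Y} {Q : Measure Y} {f : Y × X → ℝ≥0∞}

lemma map_prodMk_eq_withDensity_of_condDistrib [IsFiniteMeasure P] [StandardBorelSpace Y]
    [Nonempty Y] [SFinite Q] (hx : Measurable x) (hy : Measurable y) (hf : Measurable f)
    (h : ∀ᵐ u ∂(P.map x), condDistrib y x P u = Q.withDensity fun v => f (v, u)) :
    P.map (fun ω => (y ω, x ω)) = (Q.prod (P.map x)).withDensity f := by
  have hcomp := withDensity_compProd_eq_withDensity_prod (μ := P.map x) (ν := Q)
    (κ := condDistrib y x P) (F := 1) (f := fun p => f p.swap) measurable_one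
    (hf.comp measurable_swap) (by simpa using h)
  rw [withDensity_one, compProd_map_condDistrib hy.aemeasurable] at hcomp
  calc P.map (fun ω => (y ω, x ω)) = (P.map fun ω => (x ω, y ω)).map Prod.swap := by
        rw [Measure.map_map measurable_swap (by fun_prop)]
        rfl
    _ = (Q.prod (P.map x)).withDensity f := by
        rw [hcomp]
        exact map_swap_withDensity_prod (hf.comp measurable_swap)

variable {μ : Measure X} [SFinite μ] [SFinite Q]

lemma map_eq_withDensity_lintegral (hx : Measurable x) (hf : Measurable f)
    (h : P.map (fun ω => (y ω, x ω)) = (Q.prod μ).withDensity f) :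
    P.map y = Q.withDensity fun v => ∫⁻ u, f (v, u) ∂μ := by
  rw [← fst_withDensity_prod hf, ← h, Measure.fst_map_prodMk hx]

variable [IsFiniteMeasure P]

lemma ae_lintegral_ne_top_of_map_eq_withDensity (hx : Measurable x) (hf : Measurable f)
    (h : P.map (fun ω => (y ω, x ω)) = (Q.prod μ).withDensity f) :
    ∀ᵐ v ∂Q, ∫⁻ u, f (v, u) ∂μ ≠ ∞ := by
  refine (ae_lt_top hf.lintegral_prod_right' ?_).mono fun v hv => hv.ne
  rw [← setLIntegral_univ, ← withDensity_apply _ MeasurableSet.univ,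
    ← map_eq_withDensity_lintegral hx hf h]
  exact measure_ne_top _ _

lemma condDistrib_ae_eq_withDensity_div [StandardBorelSpace X] [Nonempty X] (hx : Measurable x)
    (hf : Measurable f) (h : P.map (fun ω => (y ω, x ω)) = (Q.prod μ).withDensity f) :
    ∀ᵐ v ∂(P.map y), condDistrib x y P v =
      μ.withDensity fun u => f (v, u) / ∫⁻ w, f (v, w) ∂μ := by
  have hF : Measurable fun v => ∫⁻ u, f (v, u) ∂μ := hf.lintegral_prod_right'
  have hdiv : Measurable (Function.uncurry fun v u => f (v, u) / ∫⁻ w, f (v, w) ∂μ) :=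
    hf.div (hF.comp measurable_fst)
  let κ : Kernel Y X := (Kernel.const Y μ).withDensity fun v u => f (v, u) / ∫⁻ w, f (v, w) ∂μ
  have hκ : ∀ v, κ v = μ.withDensity fun u => f (v, u) / ∫⁻ w, f (v, w) ∂μ := fun v => by
    rw [Kernel.withDensity_apply _ hdiv, Kernel.const_apply]
  have : IsFiniteKernel κ := ⟨1, ENNReal.one_lt_top, fun v => by
    simp_rw [hκ, withDensity_apply _ MeasurableSet.univ, setLIntegral_univ, div_eq_mul_inv]
    rw [lintegral_mul_const _ (by fun_prop)]
    exact ENNReal.div_self_le_one⟩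
  have hdisint : P.map (fun ω => (y ω, x ω)) = P.map y ⊗ₘ κ := by
    rw [h, map_eq_withDensity_lintegral hx hf h]
    refine (withDensity_compProd_eq_withDensity_prod hF hf ?_).symm
    filter_upwards [ae_lintegral_ne_top_of_map_eq_withDensity hx hf h] with v hv
    rw [hκ, lintegral_smul_withDensity_div (by fun_prop) hv]
  filter_upwards [condDistrib_ae_eq_of_measure_eq_compProd y hx.aemeasurable hdisint] with v hv
  rw [hv, hκ]

end ConditionalLaw

section BayesFormula

variable {X : Type*} [MeasurableSpace X] {μ : Measure X} {Φ Ψ : X → ℝ}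

lemma posterior_congr_ae (h : Φ =ᵐ[μ] Ψ) : posterior μ Φ = posterior μ Ψ :=
  tilted_congr (h.mono fun _ hx => congrArg Neg.neg hx)

lemma withDensity_div_lintegral_eq_posterior [NeZero μ] (hΨ : Measurable Ψ) {c : ℝ} (hc : 0 < c)
    (hfin : ∫⁻ u, ENNReal.ofReal (Real.exp (-Ψ u) / c) ∂μ ≠ ∞) :
    (μ.withDensity fun u => ENNReal.ofReal (Real.exp (-Ψ u) / c) /
      ∫⁻ w, ENNReal.ofReal (Real.exp (-Ψ w) / c) ∂μ) = posterior μ Ψ := by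
  have hnonneg : 0 ≤ᵐ[μ] fun u => Real.exp (-Ψ u) / c :=
    ae_of_all _ fun u => div_nonneg (Real.exp_pos _).le hc.le
  have hint : Integrable (fun u => Real.exp (-Ψ u) / c) μ :=
    (lintegral_ofReal_ne_top_iff_integrable (by fun_prop) hnonneg).1 hfin
  have hZ : 0 < ∫ u, Real.exp (-Ψ u) ∂μ :=
    integral_exp_pos ((hint.mul_const c).congr (ae_of_all _ fun u => div_mul_cancel₀ _ hc.ne'))
  rw [← ofReal_integral_eq_lintegral_ofReal hint hnonneg, integral_div, posterior]
  congr with u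
  rw [← ENNReal.ofReal_div_of_pos (div_pos hZ hc), div_div_div_cancel_right₀ hc.ne']

theorem condDistrib_ae_eq_posterior {Y Ω : Type*} [StandardBorelSpace X] [Nonempty X]
    [MeasurableSpace Y] [StandardBorelSpace Y] [Nonempty Y] [MeasurableSpace Ω] {P : Measure Ω}
    [IsProbabilityMeasure P] {x : Ω → X} {y : Ω → Y} (hx : Measurable x) (hy : Measurable y)
    {Q : Measure Y} [SigmaFinite Q] {Φ : X → Y → ℝ} {Z₀ : Y → ℝ}
    (hΦm : AEMeasurable (fun p : X × Y => Φ p.1 p.2) ((P.map x).prod Q))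
    (hZ₀m : Measurable Z₀) (hZ₀ : ∀ v, 0 < Z₀ v)
    (hac : ∀ᵐ u ∂(P.map x), condDistrib y x P u ≪ Q)
    (hdens : ∀ᵐ u ∂(P.map x), (condDistrib y x P u).rnDeriv Q =ᵐ[Q]
      fun v => ENNReal.ofReal (Real.exp (-Φ u v) / Z₀ v)) :
    ∀ᵐ v ∂(P.map y), condDistrib x y P v = posterior (P.map x) fun u => Φ u v := by
  have : IsProbabilityMeasure (P.map x) := Measure.isProbabilityMeasure_map hx.aemeasurable
  obtain ⟨Φ', hΦ'm, hΦ'⟩ := hΦm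
  have hfm : Measurable fun p : Y × X => ENNReal.ofReal (Real.exp (-Φ' p.swap) / Z₀ p.1) := by
    fun_prop
  have hjoint := map_prodMk_eq_withDensity_of_condDistrib (P := P) (Q := Q) hx hy hfm (by
    filter_upwards [hac, hdens, Measure.ae_ae_of_ae_prod hΦ'] with u hacu hdensu hΦu
    rw [← Measure.withDensity_rnDeriv_eq _ _ hacu]
    refine withDensity_congr_ae ?_
    filter_upwards [hdensu, hΦu] with v hv hΦv
    rw [hv, hΦv, Prod.swap_prod_mk])
  have hfin := ae_lintegral_ne_top_of_map_eq_withDensity hx hfm hjoint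
  have hae : ∀ᵐ v ∂Q, (fun u => Φ u v) =ᵐ[P.map x] fun u => Φ' (u, v) := by
    rw [← Measure.prod_swap] at hΦ'
    exact Measure.ae_ae_of_ae_prod (ae_of_ae_map measurable_swap.aemeasurable hΦ')
  have hyQ : P.map y ≪ Q :=
    map_eq_withDensity_lintegral hx hfm hjoint ▸ withDensity_absolutelyContinuous _ _
  filter_upwards [condDistrib_ae_eq_withDensity_div hx hfm hjoint, hyQ.ae_le hfin,
    hyQ.ae_le hae] with v hv hfinv haev
  rw [hv, posterior_congr_ae haev]
  exact withDensity_div_lintegral_eq_posterior (by fun_prop) (hZ₀ v) hfinv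

end BayesFormula

lemma continuous_of_lipschitz_on_bounded {X Y : Type*} [SeminormedAddCommGroup X] [Norm Y]
    {Φ : X → Y → ℝ} (h : ∀ r : ℝ, 0 < r → ∃ K : ℝ, ∀ (u₁ u₂ : X) (v : Y),
      ‖u₁‖ < r → ‖u₂‖ < r → ‖v‖ < r → |Φ u₁ v - Φ u₂ v| ≤ K * ‖u₁ - u₂‖) (v : Y) :
    Continuous fun u => Φ u v := by
  refine continuous_iff_continuousAt.2 fun u => ?_
  obtain ⟨K, hK⟩ := h (max (‖u‖ + 1) (‖v‖ + 1)) (by positivity)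
  have hlim : Tendsto (fun w => K * ‖w - u‖) (𝓝 u) (𝓝 0) := by
    simpa using (show Continuous fun w => K * ‖w - u‖ by fun_prop).tendsto u
  refine tendsto_iff_dist_tendsto_zero.2
    (squeeze_zero' (Eventually.of_forall fun _ => dist_nonneg) ?_ hlim)
  filter_upwards [continuous_norm.continuousAt.eventually (gt_mem_nhds (lt_add_one ‖u‖))]
    with w hw
  exact hK w u v (lt_max_of_lt_left hw) (lt_max_of_lt_left (lt_add_one _))
    (lt_max_of_lt_right (lt_add_one _))

end BayesMAP

theorem mainTheorem12_general
    {X : Type*} [NormedAddCommGroup X] [InnerProductSpace ℝ X] [CompleteSpace X]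
    [SecondCountableTopology X] [MeasurableSpace X] [BorelSpace X]
    {Y : Type*} [MeasurableSpace Y] [StandardBorelSpace Y] [Nonempty Y]
    {Ω : Type*} [MeasurableSpace Ω] (P : Measure Ω) [IsProbabilityMeasure P]
    (x : Ω → X) (y : Ω → Y) (hxm : Measurable x) (hym : Measurable y)
    (hx : IsGaussian (P.map x)) (Q : Measure Y) [SigmaFinite Q] (Φ : X → Y → ℝ) (Z₀ : Y → ℝ)
    (hΦm : AEMeasurable (fun p : X × Y => Φ p.1 p.2) ((P.map x).prod Q))
    (hZ₀m : Measurable Z₀) (hZ₀ : ∀ v, 0 < Z₀ v)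
    (hac : ∀ᵐ u ∂(P.map x), condDistrib y x P u ≪ Q)
    (hdens : ∀ᵐ u ∂(P.map x), (condDistrib y x P u).rnDeriv Q =ᵐ[Q]
      fun v => ENNReal.ofReal (Real.exp (-Φ u v) / Z₀ v)) :
    (∀ᵐ v ∂(P.map y), condDistrib x y P v = BayesMAP.posterior (P.map x) fun u => Φ u v) ∧
    ∀ v : Y, Continuous (fun u => Φ u v) →
      (Integrable (fun u => Real.exp (-Φ u v)) (P.map x) →
        ∀ z, BayesMAP.IsMAPEstimator (BayesMAP.posterior (P.map x) fun u => Φ u v) z →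
          ∀ u, BayesMAP.onsagerMachlup (P.map x) (fun w => Φ w v) z ≤
            BayesMAP.onsagerMachlup (P.map x) (fun w => Φ w v) u) ∧
      ((∃ M : ℝ, ∀ u, M ≤ Φ u v) →
        ∀ z, (∀ u, BayesMAP.onsagerMachlup (P.map x) (fun w => Φ w v) z ≤
          BayesMAP.onsagerMachlup (P.map x) (fun w => Φ w v) u) →
        z - ∫ u, u ∂(P.map x) ∈ BayesMAP.cameronMartinSpace (P.map x) ∧
        BayesMAP.IsMAPEstimator (BayesMAP.posterior (P.map x) fun u => Φ u v) z) := by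
  refine ⟨BayesMAP.condDistrib_ae_eq_posterior hxm hym hΦm hZ₀m hZ₀ hac hdens,
    fun v hcont => ⟨fun hint z hz => ?_, fun ⟨M, hM⟩ z hz => ⟨?_, ?_⟩⟩⟩
  · exact ((BayesMAP.isMAPEstimator_posterior_iff hint).1 hz).onsagerMachlup_le hcont
  · exact BayesMAP.sub_mean_mem_cameronMartinSpace_of_forall_le hz
  · have hint := BayesMAP.integrable_exp_neg_of_forall_le (μ := P.map x) hcont hM
    exact (BayesMAP.isMAPEstimator_posterior_iff hint).2
      (BayesMAP.isMAPEstimator_gibbsMeasure_of_forall_le hcont hM hz)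

theorem mainTheorem12
    {X : Type*} [NormedAddCommGroup X] [InnerProductSpace ℝ X] [CompleteSpace X]
    [SecondCountableTopology X] [MeasurableSpace X] [BorelSpace X]
    {J : ℕ}
    {Ω : Type*} [MeasurableSpace Ω] (P : Measure Ω) [IsProbabilityMeasure P]
    -- the unknown `x`, the model reduction error `ε`, the noise `η`, the forward map `G`
    (x : Ω → X) (ε η : Ω → EuclideanSpace ℝ (Fin J)) (G : X → EuclideanSpace ℝ (Fin J))
    (hxm : Measurable x) (hεm : Measurable ε) (hηm : Measurable η) (hGm : Measurable G)
    -- `(ε, x)` is jointly Gaussian, so that the prior `μ₀ = P.map x` and the law of `ε` are Gaussian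
    (hεx : IsGaussian (P.map fun ω => (ε ω, x ω)))
    -- the noise is centred Gaussian and independent of `x` and of `ε`
    (hη : IsGaussian (P.map η)) (hη0 : ∫ ω, η ω ∂P = 0)
    (hηx : IndepFun η x P) (hηε : IndepFun η ε P)
    -- the data
    (y : Ω → EuclideanSpace ℝ (Fin J)) (hy : ∀ ω, y ω = G (x ω) + ε ω + η ω)
    -- the potential: for almost every `u` the conditional law of `y` given `x = u` has the density
    -- `exp (-Φ(u; v)) / Z₀ v` with respect to the law of the noise
    (Φ : X → EuclideanSpace ℝ (Fin J) → ℝ) (Z₀ : EuclideanSpace ℝ (Fin J) → ℝ)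
    (hΦm : AEMeasurable (fun p : X × EuclideanSpace ℝ (Fin J) => Φ p.1 p.2)
      ((P.map x).prod (P.map η)))
    (hZ₀m : Measurable Z₀) (hZ₀ : ∀ v, 0 < Z₀ v)
    (hac : ∀ᵐ u ∂(P.map x), condDistrib y x P u ≪ P.map η)
    (hdens : ∀ᵐ u ∂(P.map x), (condDistrib y x P u).rnDeriv (P.map η) =ᵐ[P.map η]
      fun v => ENNReal.ofReal (Real.exp (-Φ u v) / Z₀ v))
    -- the potential is Lipschitz in its first argument on bounded sets
    (hΦL : ∀ r : ℝ, 0 < r → ∃ K : ℝ, 0 < K ∧ ∀ (u₁ u₂ : X) (v : EuclideanSpace ℝ (Fin J)),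
      ‖u₁‖ < r → ‖u₂‖ < r → ‖v‖ < r → |Φ u₁ v - Φ u₂ v| ≤ K * ‖u₁ - u₂‖) :
    -- the conditional law of `x` given `y = v` is the posterior measure with potential `Φ(·; v)`
    (∀ᵐ v ∂(P.map y), condDistrib x y P v = BayesMAP.posterior (P.map x) fun u => Φ u v) ∧
    -- for data `v` with `Φ(·; v)` bounded below: MAP estimators are minimisers, and conversely
    ∀ v : EuclideanSpace ℝ (Fin J), (∃ M : ℝ, ∀ u, M ≤ Φ u v) →
      (∀ z, BayesMAP.IsMAPEstimator (BayesMAP.posterior (P.map x) fun u => Φ u v) z →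
        ∀ u, BayesMAP.onsagerMachlup (P.map x) (fun w => Φ w v) z ≤
          BayesMAP.onsagerMachlup (P.map x) (fun w => Φ w v) u) ∧
      (∀ z, (∀ u, BayesMAP.onsagerMachlup (P.map x) (fun w => Φ w v) z ≤
          BayesMAP.onsagerMachlup (P.map x) (fun w => Φ w v) u) →
        z - ∫ u, u ∂(P.map x) ∈ BayesMAP.cameronMartinSpace (P.map x) ∧
        BayesMAP.IsMAPEstimator (BayesMAP.posterior (P.map x) fun u => Φ u v) z) := by
  have hx : IsGaussian (P.map x) := (HasGaussianLaw.mk hεx).snd.isGaussian_map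
  have hym : Measurable y := by rw [funext hy]; fun_prop
  obtain ⟨hbayes, hmap⟩ :=
    mainTheorem12_general P x y hxm hym hx (P.map η) Φ Z₀ hΦm hZ₀m hZ₀ hac hdens
  refine ⟨hbayes, fun v hbdd => ?_⟩
  have hcont : Continuous fun u => Φ u v :=
    BayesMAP.continuous_of_lipschitz_on_bounded (fun r hr => (hΦL r hr).imp fun _ h => h.2) v
  exact ⟨(hmap v hcont).1 (hbdd.elim fun M => BayesMAP.integrable_exp_neg_of_forall_le hcont),
    (hmap v hcont).2 hbdd⟩
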